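/- Let $k$ be a field and let $S=k[x_1,\dots,x_n]$ be the polynomial ring with its standard grading, so that $n=\dim S$, and let $\mathfrak m=(x_1,\dots,x_n)$. Graded modules are $\mathbb Z$-graded. For a finitely generated graded $S$-module $M$ put $$\operatorname{reg} M=\sup\{\,j-i : \operatorname{Tor}_i^S(k,M)_j\neq 0\,\},$$ with $\operatorname{reg} 0=-\infty$. For an ideal $I\subseteq S$, a degree-preserving homomorphism $\phi:N\to N'$ of graded $S$-modules is called an $I$-approximation if there are an $S$-module $Z$, an injective homomorphism $\alpha:N\to Z$ and a surjective homomorphism $\beta:Z\to N'$ with $\phi=\beta\circ\alpha$, $I\operatorname{Coker}\alpha=0$ and $I\operatorname{Ker}\beta=0$; if $I$ is homogeneous, it is required in addition that $Z$ is graded and that $\alpha,\beta$ are degree-preserving. Let $t\ge 1$ be an integer, let $N$ and $N_1,\dots,N_d$ be finitely generated graded $S$-modules, let $\phi_i:N\to N_i$ be degree-preserving homomorphisms (not necessarily surjective) and let $I_1,\dots,I_d$ be ideals of $S$ such that 1. $\phi_i$ is an $I_i$-approximation for $i=1,\dots,d$, and 2. $\mathfrak m^t\subseteq I_1+\cdots+I_d$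 (that is, $N_1,\dots,N_d$ is a generalized approximation system of degree $t$ for $N$). Then $$\operatorname{reg} N\le \max\Big\{\max_{i=1,\dots,d}\{\operatorname{reg} N_i\}+1,\ b\Big\}+(t-1)\,n,$$ where $b$ is the largest degree of a minimal generator of $N$, i.e. of an element of a minimal system of homogeneous generators of $N$ (with $b=-\infty$ if $N=0$, and an empty maximum being $-\infty$). -/

import Mathlib

universe u v

open MvPolynomial

namespace GenApprox

/-! Throughout, the polynomial ring `S = k[x_1, …, x_n]` over a field `k` is
`MvPolynomial (Fin n) k` with its standard grading, and `MvPolynomial.idealOfVars (Fin n) k` is its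
graded maximal ideal `𝔪 = (x_1, …, x_n)`.  Graded modules are `ℤ`-graded. -/

section Graded

variable (k : Type v) [Field k] (n : ℕ)
variable {N : Type u} [AddCommGroup N] [Module (MvPolynomial (Fin n) k) N]

/-- The family `𝒩` of additive subgroups makes the `S`-module `N` a graded `S`-module:
`N` is the direct sum of the `𝒩 j`, and a form of degree `e` sends `𝒩 j` to `𝒩 (j + e)`. -/
structure IsGradedModule (𝒩 : ℤ → AddSubgroup N) : Prop where
  isInternal : DirectSum.IsInternal 𝒩
  smul_mem : ∀ {e : ℕ} {f : MvPolynomial (Fin n) k}, f.IsHomogeneous e →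
    ∀ {j : ℤ} {x : N}, x ∈ 𝒩 j → f • x ∈ 𝒩 (j + e)

variable {k n}
variable {N' : Type u} [AddCommGroup N'] [Module (MvPolynomial (Fin n) k) N']

/-- A homomorphism is graded of degree `0` (degree-preserving). -/
def IsDegreePreserving (𝒩 : ℤ → AddSubgroup N) (𝒩' : ℤ → AddSubgroup N')
    (φ : N →ₗ[MvPolynomial (Fin n) k] N') : Prop :=
  ∀ j : ℤ, ∀ x ∈ 𝒩 j, φ x ∈ 𝒩' j

attribute [local instance] MvPolynomial.gradedAlgebra

/-- The degree-preserving homomorphism `φ : N → N'` of graded modules is an `I`-approximation: it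
factors as `N ↪ Z ↠ N'` where `I` annihilates the cokernel of the injection and the kernel of the
surjection; if the ideal `I` is homogeneous, then moreover `Z` is graded and the two maps are
degree-preserving. -/
def IsApproximation (𝒩 : ℤ → AddSubgroup N) (𝒩' : ℤ → AddSubgroup N')
    (I : Ideal (MvPolynomial (Fin n) k)) (φ : N →ₗ[MvPolynomial (Fin n) k] N') : Prop :=
  ∃ (Z : Type u) (_ : AddCommGroup Z) (_ : Module (MvPolynomial (Fin n) k) Z)
    (α : N →ₗ[MvPolynomial (Fin n) k] Z) (β : Z →ₗ[MvPolynomial (Fin n) k] N'),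
    β ∘ₗ α = φ ∧
    Function.Injective α ∧ Function.Surjective β ∧
    I ≤ Module.annihilator (MvPolynomial (Fin n) k) (Z ⧸ LinearMap.range α) ∧
    I ≤ Module.annihilator (MvPolynomial (Fin n) k) (LinearMap.ker β) ∧
    (I.IsHomogeneous (homogeneousSubmodule (Fin n) k) →
      ∃ 𝒵 : ℤ → AddSubgroup Z, IsGradedModule k n 𝒵 ∧
        IsDegreePreserving 𝒩 𝒵 α ∧ IsDegreePreserving 𝒵 𝒩' β)

/-- `N_1, …, N_d`, together with the degree-preserving maps `φ_i : N → N_i` and the ideals `I_i`,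
is a generalized approximation system of degree `t` for `N`: each `φ_i` is an `I_i`-approximation
and `𝔪 ^ t ⊆ I_1 + ⋯ + I_d`.  (The `N_i` are meant to be finitely generated graded modules.) -/
structure IsGeneralizedApproximationSystem (t : ℕ) (𝒩 : ℤ → AddSubgroup N) {d : ℕ}
    {P : Fin d → Type u} [∀ i, AddCommGroup (P i)] [∀ i, Module (MvPolynomial (Fin n) k) (P i)]
    (𝒢 : ∀ i, ℤ → AddSubgroup (P i)) (φ : ∀ i, N →ₗ[MvPolynomial (Fin n) k] P i)
    (I : Fin d → Ideal (MvPolynomial (Fin n) k)) : Prop where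
  isDegreePreserving : ∀ i, IsDegreePreserving 𝒩 (𝒢 i) (φ i)
  isApproximation : ∀ i, IsApproximation 𝒩 (𝒢 i) (I i) (φ i)
  pow_le : idealOfVars (Fin n) k ^ t ≤ ⨆ i, I i

end Graded

section Tor

variable (k : Type v) [Field k] (n : ℕ)
variable (N : Type u) [AddCommGroup N] [Module (MvPolynomial (Fin n) k) N]

/-- The differential of the Koszul complex `K(x_1, …, x_n; N)`.  A chain `∑_A e_A ⊗ c_A`, where
`e_A = e_{a_1} ∧ ⋯ ∧ e_{a_i}` for `A = {a_1 < ⋯ < a_i}`, is the function `A ↦ c_A`; the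
differential is `e_A ⊗ c ↦ ∑_{a ∈ A} (-1) ^ #{b ∈ A | b < a} e_{A \ {a}} ⊗ x_a c`, which is
written here in terms of the coefficient at each `B = A \ {a}`. -/
noncomputable def koszulD :
    (Finset (Fin n) → N) →ₗ[MvPolynomial (Fin n) k] (Finset (Fin n) → N) where
  toFun c B := ∑ a ∈ Bᶜ, (-1 : MvPolynomial (Fin n) k) ^ (B.filter (· < a)).card •
    (X a : MvPolynomial (Fin n) k) • c (insert a B)
  map_add' c c' := by
    funext B
    simp [Finset.sum_add_distrib]
  map_smul' r c := by
    funext B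
    simp only [Pi.smul_apply, RingHom.id_apply, Finset.smul_sum]
    refine Finset.sum_congr rfl fun a _ => ?_
    rw [smul_comm _ r, smul_comm _ r]

variable {n N}

/-- The Koszul differential squares to zero. -/
theorem koszulD_koszulD (c : Finset (Fin n) → N) : koszulD k n N (koszulD k n N c) = 0 := by
  funext B
  simp only [koszulD, LinearMap.coe_mk, AddHom.coe_mk, Pi.zero_apply, Finset.smul_sum]
  rw [Finset.sum_sigma']
  refine Finset.sum_involution (fun p _ => ⟨p.2, p.1⟩) ?_ ?_ ?_ ?_
  · rintro ⟨a, b⟩ h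
    simp only [Finset.mem_sigma, Finset.mem_compl, Finset.mem_insert, not_or] at h
    obtain ⟨ha, hba, hb⟩ := h
    rw [Finset.insert_comm b a, Finset.filter_insert, Finset.filter_insert]
    simp only [smul_smul, ← add_smul]
    rcases lt_or_gt_of_ne hba with hlt | hlt
    · rw [if_neg (not_lt.2 hlt.le), if_pos hlt, Finset.card_insert_of_notMem (by simp [hb])]
      refine Eq.trans ?_ (zero_smul (MvPolynomial (Fin n) k) (c (insert a (insert b B))))
      congr 1
      ring
    · rw [if_pos hlt, if_neg (not_lt.2 hlt.le), Finset.card_insert_of_notMem (by simp [ha])]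
      refine Eq.trans ?_ (zero_smul (MvPolynomial (Fin n) k) (c (insert a (insert b B))))
      congr 1
      ring
  · rintro ⟨a, b⟩ h _ heq
    simp only [Finset.mem_sigma, Finset.mem_compl, Finset.mem_insert, not_or] at h
    simp only [Sigma.mk.injEq] at heq
    exact h.2.1 heq.1
  · rintro ⟨a, b⟩ h
    simp only [Finset.mem_sigma, Finset.mem_compl, Finset.mem_insert, not_or] at h ⊢
    exact ⟨h.2.2, fun e => h.2.1 e.symm, h.1⟩
  · rintro ⟨a, b⟩ _
    rfl

/-- `K_1(S) → K_0(S) = S → S / 𝔪 → 0` is exact: the boundaries in `S` are the elements of `𝔪`. -/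
theorem koszulD_augmentation (p : MvPolynomial (Fin n) k) :
    p ∈ idealOfVars (Fin n) k ↔ ∃ e : Finset (Fin n) → MvPolynomial (Fin n) k,
      (∀ A, A.card ≠ 1 → e A = 0) ∧ koszulD k n _ e ∅ = p := by
  have key : ∀ e : Finset (Fin n) → MvPolynomial (Fin n) k,
      koszulD k n _ e ∅ = ∑ a, e {a} * X a := fun e => by
    simp [koszulD, mul_comm]
  simp only [key, idealOfVars, Ideal.mem_span_range_iff_exists_fun]
  constructor
  · rintro ⟨c, hc⟩
    refine ⟨fun A => if A.card = 1 then ∑ a ∈ A, c a else 0, fun A hA => by simp [hA], ?_⟩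
    simpa using hc
  · rintro ⟨e, -, he⟩
    exact ⟨fun a => e {a}, he⟩

/-- The Koszul complex of `S = k[x_1, …, x_n]` is exact in positive homological degrees. -/
theorem koszulD_exact (i : ℕ) (c : Finset (Fin n) → MvPolynomial (Fin n) k)
    (hc : ∀ A, A.card ≠ i + 1 → c A = 0) (hd : koszulD k n _ c = 0) :
    ∃ e : Finset (Fin n) → MvPolynomial (Fin n) k,
      (∀ A, A.card ≠ i + 2 → e A = 0) ∧ koszulD k n _ e = c := by
  suffices H : ∀ r ≤ n, ∀ (i : ℕ) (c : Finset (Fin n) → MvPolynomial (Fin n) k),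
      (∀ A, c A ≠ 0 → (∀ a ∈ A, a.val < r) ∧ A.card = i + 1) → koszulD k n _ c = 0 →
      ∃ e : Finset (Fin n) → MvPolynomial (Fin n) k,
        (∀ A, e A ≠ 0 → (∀ a ∈ A, a.val < r) ∧ A.card = i + 2) ∧ koszulD k n _ e = c by
    obtain ⟨e, he, hde⟩ := H n le_rfl i c
      (fun A hA => ⟨fun a _ => a.2, by_contra fun h => hA (hc A h)⟩) hd
    exact ⟨e, fun A hA => by_contra fun h => hA (he A h).2, hde⟩
  clear hc hd c i
  intro r
  induction r with
  | zero =>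
    intro _ i c hc _
    refine ⟨0, fun A hA => absurd rfl hA, ?_⟩
    rw [map_zero]
    funext A
    by_contra h
    obtain ⟨h1, h2⟩ := hc A (Ne.symm h)
    have : A = ∅ := Finset.eq_empty_of_forall_notMem fun a ha => absurd (h1 a ha) (by simp)
    simp [this] at h2
  | succ r ih =>
    intro hr i c hc hd
    have ih := ih (by omega)
    obtain ⟨v, hv⟩ : ∃ v : Fin n, v.val = r := ⟨⟨r, hr⟩, rfl⟩
    let J : (Finset (Fin n) → MvPolynomial (Fin n) k) → Finset (Fin n) → MvPolynomial (Fin n) k :=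
      fun e B => if v ∈ B then e (B.erase v) else 0
    -- `d (J e) = J (d e) + (-1) ^ j x_v e`
    have hJ : ∀ (j : ℕ) (e : Finset (Fin n) → MvPolynomial (Fin n) k),
        (∀ A, e A ≠ 0 → (∀ a ∈ A, a.val < r) ∧ A.card = j) → ∀ B,
        koszulD k n _ (J e) B = J (koszulD k n _ e) B + (-1) ^ j * (X v * e B) := by
      intro j e he B
      have hev : ∀ A, v ∈ A → e A = 0 := fun A hA => by
        by_contra h
        have := (he A h).1 v hA
        omega
      by_cases hB : v ∈ B
      · simp only [J, koszulD, LinearMap.coe_mk, AddHom.coe_mk, if_pos hB, hev B hB, mul_zero,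
          add_zero, smul_eq_mul]
        have : (B.erase v)ᶜ = insert v Bᶜ := by
          ext a
          by_cases h : a = v <;> simp [h]
        rw [this, Finset.sum_insert (by simpa using hB), hev _ (Finset.mem_insert_self _ _)]
        simp only [mul_zero, zero_add]
        refine Finset.sum_congr rfl fun a ha => ?_
        rw [Finset.mem_compl] at ha
        have hav : a ≠ v := fun h => ha (h ▸ hB)
        rw [if_pos (Finset.mem_insert_of_mem hB), Finset.erase_insert_of_ne hav]
        by_cases h0 : e (insert a (B.erase v)) = 0
        · simp [h0]
        · have har := (he _ h0).1 a (Finset.mem_insert_self _ _)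
          congr 3
          ext b
          simp only [Finset.mem_filter, Finset.mem_erase]
          constructor
          · rintro ⟨h1, h2⟩
            refine ⟨⟨?_, h1⟩, h2⟩
            rintro rfl
            have : b.val < a.val := h2
            omega
          · rintro ⟨h1, h2⟩
            exact ⟨h1.2, h2⟩
      · simp only [J, koszulD, LinearMap.coe_mk, AddHom.coe_mk, if_neg hB, zero_add, smul_eq_mul]
        rw [Finset.sum_eq_single v]
        · rw [if_pos (Finset.mem_insert_self _ _), Finset.erase_insert hB]
          by_cases h0 : e B = 0
          · simp [h0]
          · obtain ⟨h1, h2⟩ := he B h0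
            rw [Finset.filter_true_of_mem, h2]
            intro b hb
            have := h1 b hb
            exact Fin.lt_def.2 (by omega)
        · intro a _ hav
          rw [if_neg (by simp [hB, Ne.symm hav])]
          simp
        · intro h
          exact absurd (Finset.mem_compl.2 hB) h
    let c0 : Finset (Fin n) → MvPolynomial (Fin n) k := fun B => if v ∈ B then 0 else c B
    let c1 : Finset (Fin n) → MvPolynomial (Fin n) k :=
      fun B => if v ∈ B then 0 else c (insert v B)
    have hlt : ∀ a : Fin n, a.val < r + 1 → a ≠ v → a.val < r := fun a h1 h2 => by
      have : a.val ≠ v.val := fun h => h2 (Fin.ext h)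
      omega
    have hcJ : c = c0 + J c1 := by
      funext B
      by_cases hB : v ∈ B
      · simp [c0, c1, J, hB, Finset.insert_erase hB]
      · simp [c0, J, hB]
    have hc0 : ∀ A, c0 A ≠ 0 → (∀ a ∈ A, a.val < r) ∧ A.card = i + 1 := by
      intro A hA
      by_cases hvA : v ∈ A
      · simp [c0, hvA] at hA
      · simp only [c0, if_neg hvA] at hA
        obtain ⟨h1, h2⟩ := hc A hA
        exact ⟨fun a ha => hlt a (h1 a ha) (fun h => hvA (h ▸ ha)), h2⟩
    have hc1 : ∀ A, c1 A ≠ 0 → (∀ a ∈ A, a.val < r) ∧ A.card = i := by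
      intro A hA
      by_cases hvA : v ∈ A
      · simp [c1, hvA] at hA
      · simp only [c1, if_neg hvA] at hA
        obtain ⟨h1, h2⟩ := hc _ hA
        rw [Finset.card_insert_of_notMem hvA] at h2
        exact ⟨fun a ha => hlt a (h1 a (Finset.mem_insert_of_mem ha)) (fun h => hvA (h ▸ ha)),
          by omega⟩
    have hsup : ∀ (j : ℕ) (e : Finset (Fin n) → MvPolynomial (Fin n) k),
        (∀ A, e A ≠ 0 → (∀ a ∈ A, a.val < r) ∧ A.card = j) → ∀ B, v ∈ B →
          koszulD k n _ e B = 0 := by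
      intro j e he B hB
      simp only [koszulD, LinearMap.coe_mk, AddHom.coe_mk]
      refine Finset.sum_eq_zero fun a _ => ?_
      have : e (insert a B) = 0 := by
        by_contra h
        have := (he _ h).1 v (Finset.mem_insert_of_mem hB)
        omega
      simp [this]
    have hd' : ∀ B, koszulD k n _ c0 B + (J (koszulD k n _ c1) B + (-1) ^ i * (X v * c1 B)) = 0 := by
      intro B
      rw [← hJ i c1 hc1 B, ← Pi.add_apply, ← map_add, ← hcJ, hd, Pi.zero_apply]
    have hdc1 : koszulD k n _ c1 = 0 := by
      funext B
      by_cases hB : v ∈ B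
      · exact hsup i c1 hc1 B hB
      · have h1 := hd' (insert v B)
        rw [hsup _ c0 hc0 _ (Finset.mem_insert_self _ _)] at h1
        simpa [J, c1, Finset.erase_insert hB] using h1
    have hdc0 : ∀ B, koszulD k n _ c0 B + (-1) ^ i * (X v * c1 B) = 0 := by
      intro B
      have h1 := hd' B
      simpa [hdc1, J] using h1
    obtain ⟨e1, he1, hde1⟩ : ∃ e1 : Finset (Fin n) → MvPolynomial (Fin n) k,
        (∀ A, e1 A ≠ 0 → (∀ a ∈ A, a.val < r) ∧ A.card = i + 1) ∧ koszulD k n _ e1 = c1 := by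
      cases i with
      | succ i => exact ih i c1 hc1 hdc1
      | zero =>
        have hmem : X v * c1 ∅ ∈ Ideal.span
            ((X : Fin n → MvPolynomial (Fin n) k) '' {a | a.val < r}) := by
          have h1 := hdc0 ∅
          rw [pow_zero, one_mul, add_comm] at h1
          rw [eq_neg_of_add_eq_zero_left h1]
          refine neg_mem ?_
          simp only [koszulD, LinearMap.coe_mk, AddHom.coe_mk]
          refine sum_mem fun a _ => ?_
          by_cases h0 : c0 (insert a ∅) = 0
          · rw [h0, smul_zero, smul_zero]
            exact zero_mem _
          · have har := (hc0 _ h0).1 a (Finset.mem_insert_self _ _)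
            rw [smul_comm]
            exact Ideal.mul_mem_right _ _ (Ideal.subset_span ⟨a, har, rfl⟩)
        have hmem' : c1 ∅ ∈ Ideal.span
            ((X : Fin n → MvPolynomial (Fin n) k) '' {a | a.val < r}) := by
          rw [mem_ideal_span_X_image] at hmem ⊢
          intro m hm
          obtain ⟨a, ha, hma⟩ := hmem (Finsupp.single v 1 + m) (by
            rw [mem_support_iff, coeff_X_mul]
            exact mem_support_iff.1 hm)
          refine ⟨a, ha, ?_⟩
          have hva : v ≠ a := by
            rintro rfl
            change v.val < r at ha
            omega
          simpa [Finsupp.single_apply, hva] using hma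
        have himg : (X : Fin n → MvPolynomial (Fin n) k) '' {a | a.val < r} =
            (X : Fin n → MvPolynomial (Fin n) k) ''
              ((Finset.univ.filter fun a : Fin n => a.val < r : Finset (Fin n)) : Set (Fin n)) := by
          simp
        rw [himg, Submodule.mem_span_image_finset_iff_exists_fun'] at hmem'
        obtain ⟨p, hp⟩ := hmem'
        refine ⟨fun A => if A.card = 1 ∧ ∀ a ∈ A, a.val < r then ∑ a ∈ A, p a else 0,
          fun A hA => ?_, ?_⟩
        · by_cases h : A.card = 1 ∧ ∀ a ∈ A, a.val < r
          · exact ⟨h.2, h.1⟩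
          · simp [h] at hA
        · funext B
          by_cases hB : B = ∅
          · subst hB
            rw [← hp, Finset.sum_filter]
            simp only [koszulD, LinearMap.coe_mk, AddHom.coe_mk]
            simp only [Finset.compl_empty]
            refine Finset.sum_congr rfl fun a _ => ?_
            by_cases har : a.val < r
            · simp [har, mul_comm]
            · simp [har]
          · have hcard : B.card ≠ 0 := by simpa using hB
            have : c1 B = 0 := by
              by_contra h
              exact hcard (hc1 B h).2
            rw [this]
            simp only [koszulD, LinearMap.coe_mk, AddHom.coe_mk]
            refine Finset.sum_eq_zero fun a ha => ?_
            rw [if_neg]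
            · simp
            · rw [Finset.card_insert_of_notMem (Finset.mem_compl.1 ha)]
              rintro ⟨h, -⟩
              omega
    obtain ⟨e0, he0, hde0⟩ := ih i (c0 + ((-1) ^ i * X v : MvPolynomial (Fin n) k) • e1)
      (fun A hA => by
        by_cases h0 : c0 A = 0
        · refine he1 A fun h1 => hA ?_
          simp [h0, h1]
        · exact hc0 A h0)
      (by
        funext B
        rw [map_add, map_smul, hde1]
        have := hdc0 B
        simp only [Pi.add_apply, Pi.smul_apply, smul_eq_mul, Pi.zero_apply]
        rw [← this]
        ring)
    refine ⟨J e1 + e0, fun A hA => ?_, ?_⟩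
    · by_cases hvA : v ∈ A
      · have h0 : e0 A = 0 := by
          by_contra h
          have := (he0 A h).1 v hvA
          omega
        simp only [J, Pi.add_apply, if_pos hvA, h0, add_zero] at hA
        obtain ⟨h1, h2⟩ := he1 _ hA
        rw [Finset.card_erase_of_mem hvA] at h2
        refine ⟨fun a ha => ?_, ?_⟩
        · by_cases hav : a = v
          · subst hav; omega
          · have := h1 a (Finset.mem_erase.2 ⟨hav, ha⟩)
            omega
        · have := Finset.card_pos.2 ⟨v, hvA⟩
          omega
      · simp only [J, Pi.add_apply, if_neg hvA, zero_add] at hA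
        obtain ⟨h1, h2⟩ := he0 _ hA
        exact ⟨fun a ha => (h1 a ha).trans (Nat.lt_succ_self r), h2⟩
    · funext B
      rw [map_add, hde0, Pi.add_apply, hJ _ e1 he1 B, hde1, hcJ]
      simp only [Pi.add_apply, Pi.smul_apply, smul_eq_mul]
      ring

variable (n)

/-- The component of degree `j` of the `i`-th module `K_i ⊗ N` of the Koszul complex: the basis
elements `e_A` with `#A = i` have degree `i`. -/
def koszulChains (n : ℕ) {N : Type u} [AddCommGroup N] (𝒩 : ℤ → AddSubgroup N) (i : ℕ) (j : ℤ) :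
    AddSubgroup (Finset (Fin n) → N) where
  carrier := {c | (∀ A, c A ∈ 𝒩 (j - i)) ∧ ∀ A, A.card ≠ i → c A = 0}
  zero_mem' := ⟨fun _ => zero_mem _, fun _ _ => rfl⟩
  add_mem' h h' := ⟨fun A => add_mem (h.1 A) (h'.1 A), fun A hA => by simp [h.2 A hA, h'.2 A hA]⟩
  neg_mem' h := ⟨fun A => neg_mem (h.1 A), fun A hA => by simp [h.2 A hA]⟩

/-- The cycles of homological degree `i` and internal degree `j`. -/
noncomputable def koszulCycles (𝒩 : ℤ → AddSubgroup N) (i : ℕ) (j : ℤ) :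
    AddSubgroup (Finset (Fin n) → N) :=
  koszulChains n 𝒩 i j ⊓ (LinearMap.ker (koszulD k n N)).toAddSubgroup

/-- The boundaries of homological degree `i` and internal degree `j`. -/
noncomputable def koszulBoundaries (𝒩 : ℤ → AddSubgroup N) (i : ℕ) (j : ℤ) :
    AddSubgroup (Finset (Fin n) → N) :=
  (koszulChains n 𝒩 (i + 1) j).map (koszulD k n N).toAddMonoidHom

/-- The graded component `Tor_i^S(k, N)_j`, computed from the Koszul complex, which is the standard
graded free resolution of `k = S / 𝔪` over `S = k[x_1, …, x_n]`
(see `koszulD_koszulD`, `koszulD_exact`, `koszulD_augmentation`). -/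
abbrev GradedTor (𝒩 : ℤ → AddSubgroup N) (i : ℕ) (j : ℤ) : Type u :=
  koszulCycles k n 𝒩 i j ⧸ (koszulBoundaries k n 𝒩 i j).addSubgroupOf (koszulCycles k n 𝒩 i j)

/-- The Castelnuovo–Mumford regularity `sup {j - i | Tor_i^S(k, N)_j ≠ 0}`; it is `-∞` for
`N = 0`. -/
noncomputable def reg (𝒩 : ℤ → AddSubgroup N) : EReal :=
  sSup {r : EReal | ∃ (i : ℕ) (j : ℤ), Nontrivial (GradedTor k n 𝒩 i j) ∧
    r = (((j - i : ℤ) : ℝ) : EReal)}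

/-- `G` is a minimal system of homogeneous generators of `N`. -/
structure IsMinimalGeneratingSet (𝒩 : ℤ → AddSubgroup N) (G : Set N) : Prop where
  homogeneous : ∀ g ∈ G, ∃ j, g ∈ 𝒩 j
  span_eq_top : Submodule.span (MvPolynomial (Fin n) k) G = ⊤
  minimal : ∀ g ∈ G, Submodule.span (MvPolynomial (Fin n) k) (G \ {g}) ≠ ⊤

/-- The largest degree of a minimal generator of `N` (`-∞` for `N = 0`). -/
noncomputable def maxGeneratorDegree (𝒩 : ℤ → AddSubgroup N) : EReal :=
  sSup {r : EReal | ∃ G : Set N, IsMinimalGeneratingSet k n 𝒩 G ∧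
    ∃ g ∈ G, ∃ j : ℤ, g ∈ 𝒩 j ∧ r = ((j : ℝ) : EReal)}

end Tor

end GenApprox

-- Of an $I_i$-approximation only one consequence is used: for $f\in I_i$, multiplication by $f$ on
-- $N$ factors through $\phi_i$ (`IsApproximation.exists_comp_eq_smul`). Unlike the approximation
-- data, this factorization passes directly to $N/\ell N\to N_i/\ell N_i$ and to extensions of $k$.
-- The claim becomes: if $\operatorname{reg} N_i\le r-1$ for all $i$ and $N_q\subseteq\mathfrak mN$
-- for $q>r$, then $\operatorname{reg} N\le r+(t-1)n$.
--
-- The proof of the claim is by hyperplane sections (`regLE_of_factorization`), with induction on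
-- the codimension $m$ of a space $W$ of linear forms that kill $N$ and with bound $r+(t-1)m$. If
-- $m=0$, then $\mathfrak mN=0$, so $N$ vanishes above degree $r$. Otherwise a general linear form
-- $\ell\notin W$ has $\mathfrak m$-power torsion kernel on $N$ and on every $N_i$. Bounded
-- regularity excludes torsion in high degrees (`RegLE.eq_zero_of_torsion`), because the socle is
-- the top Koszul homology. Hence $\operatorname{reg}(N_i/\ell N_i)\le r-1$, and by induction
-- $\operatorname{reg}(N/\ell N)\le s=r+(t-1)(m-1)$.
--
-- To return to $N$, $\ell$ must be injective in degrees at least $s+t$. If $\ell x=0$ there, then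
-- $x$ is torsion, and the absence of torsion in $N/\ell N$ above degree $s$ allows division by
-- $\ell$ repeatedly: $x=\ell^t y$ with $y$ torsion of degree at least $s\ge r$. Each $\phi_i(y)$ is
-- torsion above degree $r-1$, hence zero, so $I_i y=0$ for all $i$. As $\ell^t\in\mathfrak
-- m^t\subseteq\sum I_i$, $x=0$. Each hyperplane section thus costs $t-1$.
--
-- General linear forms need an infinite field, which base change to the algebraic closure supplies
-- (`RegLE.baseChange`, `RegLE.of_baseChange`).

universe w

namespace GenApprox

/-! ### Koszul homology and bounds on regularity -/

section Koszul

variable {k : Type v} [Field k] {n : ℕ}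
variable {N : Type u} [AddCommGroup N] [Module (MvPolynomial (Fin n) k) N]

/-- The sign with which `e_a` enters `e_A` when it is moved to its place. -/
noncomputable def koszulSign (k : Type v) [Field k] (A : Finset (Fin n)) (a : Fin n) :
    MvPolynomial (Fin n) k :=
  (-1) ^ (A.filter (· < a)).card

theorem koszulSign_mul_self (A : Finset (Fin n)) (a : Fin n) :
    koszulSign k A a * koszulSign k A a = 1 := by
  rw [koszulSign, ← mul_pow]
  simp

theorem koszulSign_insert {A : Finset (Fin n)} {a : Fin n} (ha : a ∉ A) (b : Fin n) :
    koszulSign k (insert a A) b =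
      if a < b then -koszulSign k A b else koszulSign k A b := by
  unfold koszulSign
  rw [Finset.filter_insert]
  split_ifs with h
  · rw [Finset.card_insert_of_notMem (by simp [ha]), pow_succ]
    ring
  · rfl

theorem koszulD_apply (c : Finset (Fin n) → N) (B : Finset (Fin n)) :
    koszulD k n N c B =
      ∑ a ∈ Bᶜ, koszulSign k B a • (X a : MvPolynomial (Fin n) k) • c (insert a B) :=
  rfl

/-- Exterior multiplication with `e_b` on the Koszul complex. -/
noncomputable def koszulWedge (k : Type v) [Field k] {N : Type u} [AddCommGroup N]
    [Module (MvPolynomial (Fin n) k) N] (b : Fin n) (c : Finset (Fin n) → N) :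
    Finset (Fin n) → N :=
  fun A => if b ∈ A then koszulSign k (A.erase b) b • c (A.erase b) else 0

/-- Exterior multiplication with `e_b` is a homotopy between multiplication with `x_b` and `0`. -/
theorem koszulD_koszulWedge (b : Fin n) (c : Finset (Fin n) → N) :
    koszulD k n N (koszulWedge k b c) + koszulWedge k b (koszulD k n N c) =
      (X b : MvPolynomial (Fin n) k) • c := by
  funext B
  rw [Pi.add_apply, Pi.smul_apply, koszulD_apply]
  by_cases hB : b ∈ B
  · obtain ⟨C, hC, rfl⟩ : ∃ C, b ∉ C ∧ insert b C = B :=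
      ⟨B.erase b, Finset.notMem_erase _ _, Finset.insert_erase hB⟩
    have hcompl : Cᶜ = insert b (insert b C)ᶜ := by
      ext a
      by_cases h : a = b <;> simp [h, hC]
    simp only [koszulWedge, Finset.mem_insert_self, if_true, Finset.erase_insert hC]
    -- The index `b` contributes `x_b c`; every other index occurs in both sums with opposite signs,
    -- since moving `e_b` past `e_a` changes the sign.
    rw [koszulD_apply, hcompl, Finset.sum_insert (by simp), smul_add, smul_smul,
      koszulSign_mul_self, one_smul, Finset.smul_sum, add_left_comm, ← Finset.sum_add_distrib,
      Finset.sum_eq_zero, add_zero]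
    intro a ha
    simp only [Finset.mem_compl, Finset.mem_insert, not_or] at ha
    have hb : b ∉ insert a C := by simp [Ne.symm ha.1, hC]
    rw [if_pos (by simp), Finset.insert_comm a b C, Finset.erase_insert hb,
      koszulSign_insert hC, koszulSign_insert ha.2, smul_comm (X a) _]
    simp only [smul_smul, ← add_smul]
    rcases lt_or_gt_of_ne ha.1 with h | h
    · rw [if_neg h.not_gt, if_pos h]
      refine Eq.trans ?_ (zero_smul (MvPolynomial (Fin n) k) (c (insert a C)))
      congr 1
      ring
    · rw [if_pos h, if_neg h.not_gt]
      refine Eq.trans ?_ (zero_smul (MvPolynomial (Fin n) k) (c (insert a C)))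
      congr 1
      ring
  · rw [Finset.sum_eq_single b]
    · simp only [koszulWedge, Finset.mem_insert_self, if_true, if_neg hB, add_zero,
        Finset.erase_insert hB]
      rw [smul_comm (X b) (koszulSign k B b), smul_smul, koszulSign_mul_self, one_smul]
    · intro a _ hab
      have : b ∉ insert a B := by simp [Ne.symm hab, hB]
      simp [koszulWedge, this]
    · intro h
      exact absurd (Finset.mem_compl.2 hB) h

/-- The linear form with coefficients `w`. -/
noncomputable def linForm (w : Fin n → k) : MvPolynomial (Fin n) k := ∑ b, C (w b) * X b

theorem linForm_isHomogeneous (w : Fin n → k) : (linForm w).IsHomogeneous 1 := by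
  refine IsHomogeneous.sum _ _ _ fun b _ => ?_
  simpa using (isHomogeneous_C (Fin n) (w b)).mul (isHomogeneous_X k b)

theorem linForm_add (w w' : Fin n → k) : linForm (w + w') = linForm w + linForm w' := by
  simp [linForm, add_mul, Finset.sum_add_distrib]

theorem linForm_smul (a : k) (w : Fin n → k) : linForm (a • w) = C a * linForm w := by
  simp [linForm, Finset.mul_sum, mul_assoc]

theorem linForm_single (b : Fin n) : linForm (Pi.single b (1 : k)) = X b := by
  classical
  rw [linForm, Finset.sum_eq_single b]
  · simp
  · intro a _ h
    simp [h]
  · simp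

theorem linForm_mem_idealOfVars (w : Fin n → k) : linForm w ∈ idealOfVars (Fin n) k :=
  sum_mem fun b _ => Ideal.mul_mem_left _ _ (Ideal.subset_span ⟨b, rfl⟩)

variable {𝒩 : ℤ → AddSubgroup N}

theorem IsGradedModule.C_smul_mem (h𝒩 : IsGradedModule k n 𝒩) (a : k) {q : ℤ} {x : N}
    (hx : x ∈ 𝒩 q) : (C a : MvPolynomial (Fin n) k) • x ∈ 𝒩 q := by
  simpa using h𝒩.smul_mem (isHomogeneous_C (Fin n) a) hx

theorem IsGradedModule.X_smul_mem (h𝒩 : IsGradedModule k n 𝒩) (a : Fin n) {q : ℤ} {x : N}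
    (hx : x ∈ 𝒩 q) : (X a : MvPolynomial (Fin n) k) • x ∈ 𝒩 (q + 1) := by
  simpa using h𝒩.smul_mem (isHomogeneous_X k a) hx

theorem IsGradedModule.linForm_smul_mem (h𝒩 : IsGradedModule k n 𝒩) (w : Fin n → k) {q : ℤ} {x : N}
    (hx : x ∈ 𝒩 q) : linForm w • x ∈ 𝒩 (q + 1) := by
  simpa using h𝒩.smul_mem (linForm_isHomogeneous w) hx

theorem koszulSign_smul_mem {A : Finset (Fin n)} {a : Fin n} {q : ℤ} {x : N}
    (hx : x ∈ 𝒩 q) : koszulSign k A a • x ∈ 𝒩 q := by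
  unfold koszulSign
  rcases neg_one_pow_eq_or (MvPolynomial (Fin n) k) (A.filter (· < a)).card with h | h
  · rwa [h, one_smul]
  · rw [h, neg_one_smul]
    exact neg_mem hx

theorem koszulD_apply_mem (h𝒩 : IsGradedModule k n 𝒩) {c : Finset (Fin n) → N} {q : ℤ}
    (hc : ∀ A, c A ∈ 𝒩 q) (B : Finset (Fin n)) : koszulD k n N c B ∈ 𝒩 (q + 1) := by
  rw [koszulD_apply]
  exact sum_mem fun a _ => koszulSign_smul_mem (h𝒩.X_smul_mem a (hc _))

theorem koszulD_apply_eq_zero {i : ℕ} {c : Finset (Fin n) → N}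
    (hc : ∀ A, A.card ≠ i → c A = 0) {B : Finset (Fin n)} (hB : B.card + 1 ≠ i) :
    koszulD k n N c B = 0 := by
  rw [koszulD_apply]
  refine Finset.sum_eq_zero fun a ha => ?_
  rw [hc, smul_zero, smul_zero]
  rwa [Finset.card_insert_of_notMem (Finset.mem_compl.1 ha)]

theorem koszulD_mem_koszulChains (h𝒩 : IsGradedModule k n 𝒩) {i : ℕ} {j : ℤ}
    {c : Finset (Fin n) → N} (hc : c ∈ koszulChains n 𝒩 (i + 1) j) :
    koszulD k n N c ∈ koszulChains n 𝒩 i j := by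
  refine ⟨fun B => ?_, fun B hB => koszulD_apply_eq_zero hc.2 (by omega)⟩
  have := koszulD_apply_mem h𝒩 hc.1 B
  rwa [show j - ((i + 1 : ℕ) : ℤ) + 1 = j - i by push_cast; ring] at this

theorem koszulWedge_mem_koszulChains {i : ℕ} {j : ℤ} (b : Fin n)
    {c : Finset (Fin n) → N} (hc : c ∈ koszulChains n 𝒩 i j) :
    koszulWedge k b c ∈ koszulChains n 𝒩 (i + 1) (j + 1) := by
  refine ⟨fun A => ?_, fun A hA => ?_⟩
  · rw [show j + 1 - ((i + 1 : ℕ) : ℤ) = j - i by push_cast; ring]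
    unfold koszulWedge
    split_ifs
    · exact koszulSign_smul_mem (hc.1 _)
    · exact zero_mem _
  · unfold koszulWedge
    split_ifs with h
    · rw [hc.2, smul_zero]
      rw [Finset.card_erase_of_mem h]
      have := Finset.card_pos.2 ⟨b, h⟩
      omega
    · rfl

/-- A linear form annihilates the Koszul homology. -/
theorem exists_koszulD_eq_linForm_smul (h𝒩 : IsGradedModule k n 𝒩) (w : Fin n → k) {i : ℕ} {j : ℤ}
    {c : Finset (Fin n) → N} (hc : c ∈ koszulChains n 𝒩 i j) (hd : koszulD k n N c = 0) :
    ∃ e ∈ koszulChains n 𝒩 (i + 1) (j + 1), koszulD k n N e = linForm w • c := by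
  -- The witness is the wedge of `c` with `∑ w_b e_b`; on cycles the homotopy formula loses its
  -- second term.
  refine ⟨∑ b, (C (w b) : MvPolynomial (Fin n) k) • koszulWedge k b c, sum_mem fun b _ => ?_, ?_⟩
  · have := koszulWedge_mem_koszulChains (k := k) b hc
    exact ⟨fun A => h𝒩.C_smul_mem _ (this.1 A), fun A hA => by simp [this.2 A hA]⟩
  · rw [map_sum, linForm, Finset.sum_smul]
    refine Finset.sum_congr rfl fun b _ => ?_
    have h0 : koszulWedge k b (0 : Finset (Fin n) → N) = 0 := by
      funext A
      simp [koszulWedge]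
    rw [map_smul, mul_smul, ← koszulD_koszulWedge b c, hd, h0, add_zero]

/-- `Tor_i(k, N)_j` vanishes for `j - i > s`. -/
def RegLE (k : Type v) [Field k] (n : ℕ) {N : Type u} [AddCommGroup N]
    [Module (MvPolynomial (Fin n) k) N] (𝒩 : ℤ → AddSubgroup N) (s : ℤ) : Prop :=
  ∀ (i : ℕ) (j : ℤ), s < j - i → ∀ c ∈ koszulChains n 𝒩 i j, koszulD k n N c = 0 →
    ∃ e ∈ koszulChains n 𝒩 (i + 1) j, koszulD k n N e = c

theorem nontrivial_gradedTor_iff (i : ℕ) (j : ℤ) :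
    Nontrivial (GradedTor k n 𝒩 i j) ↔
      ¬∀ c ∈ koszulChains n 𝒩 i j, koszulD k n N c = 0 →
        ∃ e ∈ koszulChains n 𝒩 (i + 1) j, koszulD k n N e = c := by
  rw [← not_subsingleton_iff_nontrivial, not_iff_not, QuotientAddGroup.subsingleton_iff,
    AddSubgroup.addSubgroupOf_eq_top]
  constructor
  · intro h c hc hd
    obtain ⟨e, he, hde⟩ := h (show c ∈ koszulCycles k n 𝒩 i j from ⟨hc, hd⟩)
    exact ⟨e, he, hde⟩
  · rintro h c ⟨hc, hd⟩
    obtain ⟨e, he, hde⟩ := h c hc hd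
    exact ⟨e, he, hde⟩

theorem RegLE.of_eq_bot {s : ℤ} (h : ∀ q, s < q → ∀ x ∈ 𝒩 q, x = 0) : RegLE k n 𝒩 s := by
  intro i j hij c hc _
  refine ⟨0, zero_mem _, ?_⟩
  rw [map_zero]
  funext A
  exact (h _ hij _ (hc.1 A)).symm

/-- A module of regularity at most `s` has no `𝔪`-torsion in degrees above `s`. -/
theorem RegLE.eq_zero_of_torsion (h𝒩 : IsGradedModule k n 𝒩) {s : ℤ} (h : RegLE k n 𝒩 s) (e : ℕ) :
    ∀ {q : ℤ} {x : N}, s < q → x ∈ 𝒩 q → (∀ f ∈ idealOfVars (Fin n) k ^ e, f • x = 0) → x = 0 := by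
  induction e with
  | zero =>
    intro q x _ _ hx
    simpa using hx 1 (by simp)
  | succ e ih =>
    intro q x hq hx htors
    -- Each `x_a x` is killed by a smaller power of `𝔪` and has higher degree, so `x` lies in the
    -- socle.
    have hX : ∀ a : Fin n, (X a : MvPolynomial (Fin n) k) • x = 0 := by
      intro a
      refine ih (q := q + 1) (by omega) (h𝒩.X_smul_mem a hx) fun f hf => ?_
      rw [smul_smul]
      exact htors _ (by rw [pow_succ]; exact Ideal.mul_mem_mul hf (Ideal.subset_span ⟨a, rfl⟩))
    -- A socle element `x` gives the cycle `e_1 ∧ ⋯ ∧ e_n ⊗ x` in homological degree `n`. It is a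
    -- boundary by the bound, but there are no nonzero chains in degree `n + 1`.
    obtain ⟨w, hw, hdw⟩ := h n (q + n) (by simpa using hq)
      (fun A => if A = Finset.univ then x else 0)
      ⟨fun A => by
        beta_reduce
        split_ifs
        · simpa using hx
        · exact zero_mem _,
      fun A hA => if_neg fun h => hA (by simp [h])⟩
      (by
        funext B
        rw [koszulD_apply]
        refine Finset.sum_eq_zero fun a _ => ?_
        split_ifs
        · rw [hX, smul_zero]
        · simp)
    have hw0 : w = 0 := by
      funext A
      refine hw.2 A fun hA => ?_
      have := Finset.card_le_univ A
      simp at this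
      omega
    rw [hw0, map_zero] at hdw
    simpa using (congrFun hdw Finset.univ).symm

end Koszul

/-! ### Internal gradings and their projections -/

section Grading

variable {N : Type u} [AddCommGroup N] {𝒩 : ℤ → AddSubgroup N}

/-- Applying the map for `q` to a vanishing sum of homogeneous elements isolates its component of
degree `q`. This criterion serves for quotients and base changes, where such maps are induced by the
projections of `N`. -/
theorem isInternal_of_separating (htop : ⨆ q, 𝒩 q = ⊤)
    (hsep : ∀ q, ∃ (Y : Type w) (_ : AddCommGroup Y) (p : N →+ Y),
      (∀ x ∈ 𝒩 q, p x = 0 → x = 0) ∧ ∀ q', q' ≠ q → ∀ x ∈ 𝒩 q', p x = 0) :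
    DirectSum.IsInternal 𝒩 := by
  constructor
  · rw [injective_iff_map_eq_zero]
    intro z hz
    refine DFinsupp.ext fun q => ?_
    obtain ⟨Y, _, p, hp, hp'⟩ := hsep q
    refine Subtype.ext (hp _ (z q).2 ?_)
    have h1 : p (DirectSum.coeAddMonoidHom 𝒩 z) = 0 := by rw [hz, map_zero]
    classical
    rw [DirectSum.coeAddMonoidHom_eq_dfinsuppSum, DFinsupp.sum, map_sum,
      Finset.sum_eq_single q] at h1
    · exact h1
    · intro q' _ hq'
      exact hp' q' hq' _ (z q').2
    · intro hq
      rw [DFinsupp.notMem_support_iff.1 hq]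
      simp
  · rw [← AddMonoidHom.range_eq_top, eq_top_iff, ← htop, iSup_le_iff]
    intro q x hx
    exact ⟨DirectSum.of (fun q => 𝒩 q) q ⟨x, hx⟩, by simp⟩

theorem iSup_eq_top_of_isInternal (h : DirectSum.IsInternal 𝒩) : ⨆ q, 𝒩 q = ⊤ := by
  rw [eq_top_iff]
  rintro x -
  obtain ⟨z, rfl⟩ := h.2 x
  classical
  rw [DirectSum.coeAddMonoidHom_eq_dfinsuppSum]
  exact sum_mem fun q _ => AddSubgroup.mem_iSup_of_mem q (z q).2

theorem exists_proj_of_isInternal (h : DirectSum.IsInternal 𝒩) :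
    ∃ p : ℤ → N →+ N, (∀ q x, p q x ∈ 𝒩 q) ∧ (∀ q, ∀ x ∈ 𝒩 q, p q x = x) ∧
      ∀ q q', q' ≠ q → ∀ x ∈ 𝒩 q', p q x = 0 := by
  let := h.chooseDecomposition
  refine ⟨fun q => ((𝒩 q).subtype.comp (DFinsupp.evalAddMonoidHom q)).comp
    (DirectSum.decomposeAddEquiv 𝒩).toAddMonoidHom, fun q x => ?_, fun q x hx => ?_,
    fun q q' hq x hx => ?_⟩
  · exact (DirectSum.decompose 𝒩 x q).2
  · exact DirectSum.decompose_of_mem_same 𝒩 hx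
  · exact DirectSum.decompose_of_mem_ne 𝒩 hx hq

end Grading

/-! ### Regularity and hyperplane sections -/

section Module

variable {k : Type v} [Field k] {n : ℕ}
variable {N : Type u} [AddCommGroup N] [Module (MvPolynomial (Fin n) k) N]
variable {𝒩 : ℤ → AddSubgroup N}

/-- Projections onto the graded components are compatible with multiplication by forms. -/
theorem IsGradedModule.proj_smul (h𝒩 : IsGradedModule k n 𝒩) {p : ℤ → N →+ N}
    (hp : ∀ q, ∀ x ∈ 𝒩 q, p q x = x) (hp' : ∀ q q', q' ≠ q → ∀ x ∈ 𝒩 q', p q x = 0)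
    {e : ℕ} {f : MvPolynomial (Fin n) k} (hf : f.IsHomogeneous e) (q : ℤ) (x : N) :
    p (q + e) (f • x) = f • p q x := by
  have hx : x ∈ ⨆ q, 𝒩 q := by
    rw [iSup_eq_top_of_isInternal h𝒩.isInternal]
    trivial
  induction hx using AddSubgroup.iSup_induction' with
  | hp q' x hx =>
    by_cases h : q' = q
    · subst h
      rw [hp _ x hx, hp _ _ (h𝒩.smul_mem hf hx)]
    · rw [hp' q q' h x hx, smul_zero, hp' _ (q' + e) (by omega) _ (h𝒩.smul_mem hf hx)]
  | h1 => simp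
  | hadd x y _ _ hx hy => rw [smul_add, map_add, map_add, smul_add, hx, hy]

/-- The component of `x` in degree `q` works, because projections commute with a linear form up to
the shift by one. It makes preimages under `ℓ` homogeneous. -/
theorem IsGradedModule.exists_smul_eq (h𝒩 : IsGradedModule k n 𝒩) {w : Fin n → k} {q : ℤ} {x : N}
    (hx : linForm w • x ∈ 𝒩 (q + 1)) : ∃ y ∈ 𝒩 q, linForm w • y = linForm w • x := by
  obtain ⟨p, hp1, hp2, hp3⟩ := exists_proj_of_isInternal h𝒩.isInternal
  refine ⟨p q x, hp1 q x, ?_⟩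
  have := h𝒩.proj_smul hp2 hp3 (linForm_isHomogeneous w) q x
  rw [← this]
  exact hp2 _ _ hx

/-- The submodule `f N`. -/
noncomputable abbrev smulRange (f : MvPolynomial (Fin n) k) (N : Type u) [AddCommGroup N]
    [Module (MvPolynomial (Fin n) k) N] : Submodule (MvPolynomial (Fin n) k) N :=
  LinearMap.range (LinearMap.lsmul (MvPolynomial (Fin n) k) N f)

theorem mem_smulRange {f : MvPolynomial (Fin n) k} {x : N} :
    x ∈ smulRange f N ↔ ∃ y, f • y = x :=
  Iff.rfl

/-- The grading of a quotient module. -/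
noncomputable def quotientGrading (𝒩 : ℤ → AddSubgroup N)
    (U : Submodule (MvPolynomial (Fin n) k) N) (q : ℤ) : AddSubgroup (N ⧸ U) :=
  (𝒩 q).map U.mkQ.toAddMonoidHom

theorem mkQ_mem_quotientGrading (U : Submodule (MvPolynomial (Fin n) k) N) {q : ℤ} {x : N}
    (hx : x ∈ 𝒩 q) : U.mkQ x ∈ quotientGrading 𝒩 U q :=
  ⟨x, hx, rfl⟩

/-- The submodule `ℓ N` is stable under the projections of `N`, so these descend and separate the
components of the quotient. -/
theorem IsGradedModule.quotient (h𝒩 : IsGradedModule k n 𝒩) (w : Fin n → k) :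
    IsGradedModule k n (quotientGrading 𝒩 (smulRange (linForm w) N)) := by
  obtain ⟨p, hp1, hp2, hp3⟩ := exists_proj_of_isInternal h𝒩.isInternal
  refine ⟨isInternal_of_separating ?_ fun q => ?_, ?_⟩
  · rw [eq_top_iff]
    rintro x -
    obtain ⟨y, rfl⟩ := Submodule.mkQ_surjective _ x
    have hy : y ∈ ⨆ q, 𝒩 q := by
      rw [iSup_eq_top_of_isInternal h𝒩.isInternal]
      trivial
    induction hy using AddSubgroup.iSup_induction' with
    | hp q y hy => exact AddSubgroup.mem_iSup_of_mem q (mkQ_mem_quotientGrading _ hy)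
    | h1 => simp
    | hadd x y _ _ hx hy =>
      rw [map_add]
      exact add_mem hx hy
  · refine ⟨N ⧸ smulRange (linForm w) N, inferInstance,
      QuotientAddGroup.map _ _ (p q) ?_, ?_, ?_⟩
    · rintro _ ⟨y, rfl⟩
      refine ⟨p (q - 1) y, ?_⟩
      have := h𝒩.proj_smul hp2 hp3 (linForm_isHomogeneous w) (q - 1) y
      simp only [Nat.cast_one, sub_add_cancel] at this
      exact this.symm
    · rintro _ ⟨y, hy, rfl⟩ h
      change (Submodule.mkQ _ (p q y)) = 0 at h
      rw [hp2 q y hy] at h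
      exact h
    · rintro q' hq' _ ⟨y, hy, rfl⟩
      change (Submodule.mkQ _ (p q y)) = 0
      rw [hp3 q q' hq' y hy, map_zero]
  · rintro e f hf j _ ⟨y, hy, rfl⟩
    exact ⟨f • y, h𝒩.smul_mem hf hy, map_smul (Submodule.mkQ _) f y⟩

theorem koszulD_mkQ (U : Submodule (MvPolynomial (Fin n) k) N) (c : Finset (Fin n) → N) :
    koszulD k n (N ⧸ U) (fun A => U.mkQ (c A)) = fun A => U.mkQ (koszulD k n N c A) := by
  funext B
  simp only [koszulD_apply, map_sum, map_smul]

theorem mkQ_mem_koszulChains (U : Submodule (MvPolynomial (Fin n) k) N) {i : ℕ} {j : ℤ}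
    {c : Finset (Fin n) → N} (hc : c ∈ koszulChains n 𝒩 i j) :
    (fun A => U.mkQ (c A)) ∈ koszulChains n (quotientGrading 𝒩 U) i j :=
  ⟨fun A => mkQ_mem_quotientGrading _ (hc.1 A),
    fun A hA => (congrArg U.mkQ (hc.2 A hA)).trans (map_zero _)⟩

theorem exists_lift_koszulChains (U : Submodule (MvPolynomial (Fin n) k) N) {i : ℕ} {j : ℤ}
    {c : Finset (Fin n) → N ⧸ U} (hc : c ∈ koszulChains n (quotientGrading 𝒩 U) i j) :
    ∃ e ∈ koszulChains n 𝒩 i j, (fun A => U.mkQ (e A)) = c := by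
  classical
  choose e he hec using hc.1
  refine ⟨fun A => if A.card = i then e A else 0, ⟨fun A => ?_, fun A hA => if_neg hA⟩, ?_⟩
  · beta_reduce
    split_ifs
    · exact he A
    · exact zero_mem _
  · funext A
    beta_reduce
    split_ifs with hA
    · exact hec A
    · rw [map_zero, hc.2 A hA]

/-- A chain with coefficients in `ℓ N` is `ℓ` times a chain. -/
theorem IsGradedModule.exists_smul_chain_eq (h𝒩 : IsGradedModule k n 𝒩) {w : Fin n → k} {i : ℕ}
    {j : ℤ} {c : Finset (Fin n) → N} (hc : c ∈ koszulChains n 𝒩 i j)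
    (hw : (fun A => (smulRange (linForm w) N).mkQ (c A)) = 0) :
    ∃ e ∈ koszulChains n 𝒩 i (j - 1), linForm w • e = c := by
  classical
  have : ∀ A, ∃ y ∈ 𝒩 (j - 1 - i), linForm w • y = c A := by
    intro A
    obtain ⟨y, hy⟩ := (Submodule.Quotient.mk_eq_zero _).1 (congrFun hw A)
    have hy : linForm w • y = c A := hy
    have h1 := hc.1 A
    rw [← hy, show j - i = j - 1 - i + 1 by ring] at h1
    obtain ⟨z, hz, hz'⟩ := h𝒩.exists_smul_eq h1
    exact ⟨z, hz, hz'.trans hy⟩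
  choose e he hec using this
  refine ⟨fun A => if A.card = i then e A else 0, ⟨fun A => ?_, fun A hA => if_neg hA⟩, ?_⟩
  · beta_reduce
    split_ifs
    · exact he A
    · exact zero_mem _
  · funext A
    rw [Pi.smul_apply]
    split_ifs with hA
    · exact hec A
    · rw [smul_zero, hc.2 A hA]

/-- If `ℓ` is a linear form without torsion in degrees above `s`, then
`reg (N / ℓ N) ≤ s` follows from `reg N ≤ s`. -/
theorem RegLE.quotient (h𝒩 : IsGradedModule k n 𝒩) {s : ℤ} (h : RegLE k n 𝒩 s) {w : Fin n → k}
    (hw : ∀ q, s < q → ∀ x ∈ 𝒩 q, linForm w • x = 0 → x = 0) :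
    RegLE k n (quotientGrading 𝒩 (smulRange (linForm w) N)) s := by
  intro i j hij c hc hd
  obtain ⟨z, hz, rfl⟩ := exists_lift_koszulChains _ hc
  rw [koszulD_mkQ] at hd
  -- It suffices to lift the cycle to a cycle of `N`, that is, to see that `Tor_i(k, N)_j` surjects
  -- onto `Tor_i(k, N/ℓN)_j`.
  suffices H : ∃ y ∈ koszulChains n 𝒩 i j, koszulD k n N y = 0 ∧
      ∀ A, (smulRange (linForm w) N).mkQ (y A) = (smulRange (linForm w) N).mkQ (z A) by
    obtain ⟨y, hy, hdy, hyz⟩ := H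
    obtain ⟨e, he, rfl⟩ := h i j hij y hy hdy
    refine ⟨fun A => (smulRange (linForm w) N).mkQ (e A),
      mkQ_mem_koszulChains _ he, ?_⟩
    rw [koszulD_mkQ]
    funext A
    exact hyz A
  cases i with
  | zero =>
    refine ⟨z, hz, ?_, fun _ => rfl⟩
    funext B
    exact koszulD_apply_eq_zero hz.2 (by omega)
  | succ i =>
    obtain ⟨z₁, hz₁, hz₁'⟩ := h𝒩.exists_smul_chain_eq (koszulD_mem_koszulChains h𝒩 hz) hd
    -- The obstruction `z₁`, with `d z = ℓ z₁`, represents the connecting map. Its differential is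
    -- killed by `ℓ` and has coefficients in degree `j - i > s`, where `ℓ` is injective.
    have hdz₁ : koszulD k n N z₁ = 0 := by
      funext B
      refine hw (j - 1 - i + 1) (by push_cast at hij; omega) _ (koszulD_apply_mem h𝒩 hz₁.1 B) ?_
      rw [← Pi.smul_apply, ← map_smul, hz₁', koszulD_koszulD]
      rfl
    obtain ⟨w₁, hw₁, hdw₁⟩ := h i (j - 1) (by push_cast at hij; omega) z₁ hz₁ hdz₁
    -- Since `z₁ = d w₁`, subtracting `ℓ w₁` makes the lift a cycle without changing its class
    -- modulo `ℓ N`.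
    refine ⟨z - linForm w • w₁, sub_mem hz ⟨fun A => ?_, fun A hA => ?_⟩, ?_, fun A => ?_⟩
    · have := h𝒩.linForm_smul_mem w (hw₁.1 A)
      rwa [show j - 1 - ((i + 1 : ℕ) : ℤ) + 1 = j - ((i + 1 : ℕ) : ℤ) by ring] at this
    · rw [Pi.smul_apply, hw₁.2 A hA, smul_zero]
    · rw [map_sub, map_smul, hdw₁, hz₁', sub_self]
    · rw [Pi.sub_apply, map_sub, sub_eq_self]
      exact (Submodule.Quotient.mk_eq_zero _).2 ⟨w₁ A, rfl⟩

/-- If `ℓ` is a linear form without torsion in degrees above `s`, then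
`reg N ≤ s` follows from `reg (N / ℓ N) ≤ s`. -/
theorem RegLE.of_quotient (h𝒩 : IsGradedModule k n 𝒩) {s : ℤ} {w : Fin n → k}
    (h : RegLE k n (quotientGrading 𝒩 (smulRange (linForm w) N)) s)
    (hw : ∀ q, s < q → ∀ x ∈ 𝒩 q, linForm w • x = 0 → x = 0) : RegLE k n 𝒩 s := by
  intro i j hij z hz hd
  obtain ⟨e, he, hde⟩ := h i j hij (fun A => (smulRange (linForm w) N).mkQ (z A))
    (mkQ_mem_koszulChains _ hz)
    (by
      rw [koszulD_mkQ, hd]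
      funext A
      exact map_zero _)
  obtain ⟨y, hy, rfl⟩ := exists_lift_koszulChains _ he
  rw [koszulD_mkQ] at hde
  obtain ⟨v, hv, hv'⟩ := h𝒩.exists_smul_chain_eq (c := z - koszulD k n N y) (w := w)
    (sub_mem hz (koszulD_mem_koszulChains h𝒩 hy)) (by
      funext A
      rw [Pi.sub_apply, map_sub, ← congrFun hde A, sub_self]
      rfl)
  -- The coefficients of `v` may lie in degree `s` itself, but those of `d v` are one degree higher,
  -- where `ℓ` is injective.
  have hdv : koszulD k n N v = 0 := by
    funext B
    refine hw (j - 1 - i + 1) (by omega) _ (koszulD_apply_mem h𝒩 hv.1 B) ?_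
    rw [← Pi.smul_apply, ← map_smul, hv', map_sub, hd, koszulD_koszulD, sub_zero]
    rfl
  -- Now `z - d y = ℓ v` with `v` a cycle, and `ℓ` acts as zero on Koszul homology.
  obtain ⟨x, hx, hdx⟩ := exists_koszulD_eq_linForm_smul h𝒩 w hv hdv
  rw [sub_add_cancel] at hx
  refine ⟨x + y, add_mem hx hy, ?_⟩
  rw [map_add, hdx, hv', sub_add_cancel]

end Module

/-! ### General linear forms and the induction -/

section Induction

variable {k : Type v} [Field k] {n : ℕ}

/-- Over an infinite field there is a linear form outside finitely many primes other than `𝔪` and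
outside a proper subspace. -/
theorem exists_linForm_notMem [Infinite k] {A : Set (Ideal (MvPolynomial (Fin n) k))}
    (hA : A.Finite) {W : Submodule k (Fin n → k)} (hW : W ≠ ⊤) :
    ∃ w, w ∉ W ∧ ∀ p ∈ A, linForm w ∈ p → idealOfVars (Fin n) k ≤ p := by
  classical
  let V : Ideal (MvPolynomial (Fin n) k) → Submodule k (Fin n → k) := fun p =>
    { carrier := {w | linForm w ∈ p}
      add_mem' := fun {a b} ha hb => by
        simp only [Set.mem_ofPred_eq, linForm_add] at *
        exact add_mem ha hb
      zero_mem' := by simp [linForm]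
      smul_mem' := fun c x hx => by
        simp only [Set.mem_ofPred_eq, linForm_smul] at *
        exact Ideal.mul_mem_left _ _ hx }
  have hV : ∀ p, V p = ⊤ → idealOfVars (Fin n) k ≤ p := by
    intro p hp
    refine Ideal.span_le.2 ?_
    rintro _ ⟨b, rfl⟩
    have : Pi.single b (1 : k) ∈ V p := by
      rw [hp]
      trivial
    change linForm _ ∈ p at this
    rwa [linForm_single] at this
  -- Over an infinite field, `W` and the finitely many proper subspaces `V p` do not cover the space
  -- of linear forms.
  have hs : (⊤ : Submodule k (Fin n → k)) ∉
      insert W ((hA.toFinset.image V).filter (· ≠ ⊤)) := by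
    simp [hW.symm]
  obtain ⟨w, hw⟩ := (Set.ne_univ_iff_exists_notMem _).1
    (Subspace.biUnion_ne_univ_of_top_notMem hs)
  simp only [Set.mem_iUnion, not_exists] at hw
  refine ⟨w, fun h => hw W (Finset.mem_insert_self _ _) h, fun p hp hwp => hV p ?_⟩
  by_contra hne
  refine hw (V p) (Finset.mem_insert_of_mem (Finset.mem_filter.2 ⟨?_, hne⟩)) hwp
  exact Finset.mem_image_of_mem _ (hA.mem_toFinset.2 hp)

variable {N : Type u} [AddCommGroup N] [Module (MvPolynomial (Fin n) k) N]

/-- If `ℓ` lies in no associated prime of `N` but possibly `𝔪`, then the kernel of `ℓ` on `N` is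
annihilated by a power of `𝔪`. -/
theorem exists_pow_smul_eq_zero [Module.Finite (MvPolynomial (Fin n) k) N] {w : Fin n → k}
    (hw : ∀ p ∈ associatedPrimes (MvPolynomial (Fin n) k) N, linForm w ∈ p →
      idealOfVars (Fin n) k ≤ p) :
    ∃ e : ℕ, ∀ x : N, linForm w • x = 0 → ∀ f ∈ idealOfVars (Fin n) k ^ e, f • x = 0 := by
  let T : Submodule (MvPolynomial (Fin n) k) N :=
    LinearMap.ker (LinearMap.lsmul (MvPolynomial (Fin n) k) N (linForm w))
  have hmem : ∀ x, x ∈ T ↔ linForm w • x = 0 := fun _ => Iff.rfl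
  -- A minimal prime over the annihilator of `ker ℓ` contains `ℓ` and is an associated prime of `N`,
  -- so it contains `𝔪` by hypothesis.
  have hle : idealOfVars (Fin n) k ≤ (Module.annihilator (MvPolynomial (Fin n) k) T).radical := by
    rw [← Ideal.sInf_minimalPrimes, le_sInf_iff]
    intro p hp
    refine hw p ?_ ?_
    · exact associatedPrimes.subset_of_injective T.injective_subtype
        (Module.associatedPrimes.minimalPrimes_annihilator_subset_associatedPrimes _ _ hp)
    · refine hp.1.2 (Module.mem_annihilator.2 fun x => Subtype.ext ?_)
      exact x.2
  obtain ⟨e, he⟩ := Ideal.exists_radical_pow_le_of_fg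
    (Module.annihilator (MvPolynomial (Fin n) k) T) (IsNoetherian.noetherian _)
  refine ⟨e, fun x hx f hf => ?_⟩
  have := Module.mem_annihilator.1 (he (Ideal.pow_right_mono hle e hf)) ⟨x, hx⟩
  exact congrArg Subtype.val this

/-- If `N / ℓ N` has no `𝔪`-torsion in degrees above `s`, then `𝔪`-torsion elements of `N` in
degrees at least `s + e` are `ℓ ^ e`-multiples of torsion elements. -/
theorem exists_torsion_pow_smul_eq {𝒩 : ℤ → AddSubgroup N} (h𝒩 : IsGradedModule k n 𝒩)
    {w : Fin n → k} {s : ℤ} (h : RegLE k n (quotientGrading 𝒩 (smulRange (linForm w) N)) s) {a : ℕ}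
    (hw : ∀ x : N, linForm w • x = 0 → ∀ f ∈ idealOfVars (Fin n) k ^ a, f • x = 0) (e : ℕ) :
    ∀ {q : ℤ} {x : N} {b : ℕ}, s + e ≤ q → x ∈ 𝒩 q →
      (∀ f ∈ idealOfVars (Fin n) k ^ b, f • x = 0) →
      ∃ y ∈ 𝒩 (q - e), linForm w ^ e • y = x ∧
        ∃ b : ℕ, ∀ f ∈ idealOfVars (Fin n) k ^ b, f • y = 0 := by
  induction e with
  | zero => exact fun {q x b} _ hx hb => ⟨x, by simpa using hx, by simp, b, hb⟩
  | succ e ih =>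
    intro q x b hq hx hb
    push_cast at hq
    have h0 := h.eq_zero_of_torsion (h𝒩.quotient w) b (by omega)
      (mkQ_mem_quotientGrading (smulRange (linForm w) N) hx) fun f hf => by
        rw [← map_smul, hb f hf, map_zero]
    obtain ⟨y, rfl⟩ := mem_smulRange.1 ((Submodule.Quotient.mk_eq_zero _).1 h0)
    obtain ⟨z, hz, hzy⟩ := h𝒩.exists_smul_eq (q := q - 1) (by rwa [sub_add_cancel])
    rw [← hzy] at hb ⊢
    -- The quotient `z` of `x` by `ℓ` is again torsion: `𝔪 ^ b z` lies in `ker ℓ`, which `𝔪 ^ a`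
    -- kills.
    obtain ⟨z', hz', rfl, hb'⟩ := ih (q := q - 1) (x := z) (b := a + b) (by omega) hz
      fun f hf => by
        rw [pow_add] at hf
        refine Submodule.mul_induction_on hf (fun f hf g hg => ?_) fun f g hf hg => ?_
        · rw [mul_smul]
          refine hw _ ?_ f hf
          rw [smul_comm, hb g hg]
        · rw [add_smul, hf, hg, add_zero]
    refine ⟨z', by rwa [show q - ((e + 1 : ℕ) : ℤ) = q - 1 - e by push_cast; ring], ?_, hb'⟩
    rw [pow_succ', mul_smul]

/-- Hyperplane section induction. -/
theorem regLE_of_factorization [Infinite k] {d t : ℕ} (ht : 1 ≤ t)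
    (I : Fin d → Ideal (MvPolynomial (Fin n) k)) (hI : idealOfVars (Fin n) k ^ t ≤ ⨆ i, I i)
    {r : ℤ} (m : ℕ) :
    ∀ {N : Type u} [AddCommGroup N] [Module (MvPolynomial (Fin n) k) N]
      [Module.Finite (MvPolynomial (Fin n) k) N]
      {𝒩 : ℤ → AddSubgroup N} (_ : IsGradedModule k n 𝒩)
      {P : Fin d → Type u} [∀ i, AddCommGroup (P i)] [∀ i, Module (MvPolynomial (Fin n) k) (P i)]
      [∀ i, Module.Finite (MvPolynomial (Fin n) k) (P i)]
      {𝒢 : ∀ i, ℤ → AddSubgroup (P i)} (_ : ∀ i, IsGradedModule k n (𝒢 i))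
      (φ : ∀ i, N →ₗ[MvPolynomial (Fin n) k] P i)
      (_ : ∀ i, IsDegreePreserving 𝒩 (𝒢 i) (φ i))
      (_ : ∀ i, ∀ f ∈ I i, ∃ g : P i →ₗ[MvPolynomial (Fin n) k] N, ∀ x, g (φ i x) = f • x)
      (_ : ∀ i, RegLE k n (𝒢 i) (r - 1))
      (_ : ∀ q, r < q → ∀ x ∈ 𝒩 q,
        x ∈ idealOfVars (Fin n) k • (⊤ : Submodule (MvPolynomial (Fin n) k) N))
      (W : Submodule k (Fin n → k)) (_ : Module.finrank k W + m = n)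
      (_ : ∀ w ∈ W, ∀ x : N, linForm w • x = 0),
      RegLE k n 𝒩 (r + (t - 1) * m) := by
  induction m with
  | zero =>
    intro N _ _ _ 𝒩 h𝒩 P _ _ _ 𝒢 h𝒢 φ hφ hg hreg hgen W hW hWN
    have hWtop : W = ⊤ := Submodule.eq_top_of_finrank_eq (by simpa using hW)
    refine RegLE.of_eq_bot fun q hq x hx => ?_
    have hx' := hgen q (by simpa using hq) x hx
    refine Submodule.smul_induction_on hx' (fun f hf y _ => ?_) fun y z hy hz => by
      rw [hy, hz, add_zero]
    refine Submodule.span_induction ?_ (zero_smul _ _) (fun a b _ _ ha hb => by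
      rw [add_smul, ha, hb, add_zero]) (fun a b _ hb => by rw [smul_eq_mul, mul_smul, hb,
        smul_zero]) hf
    rintro _ ⟨b, rfl⟩
    rw [← linForm_single]
    exact hWN _ (by rw [hWtop]; trivial) y
  | succ m ih =>
    intro N _ _ _ 𝒩 h𝒩 P _ _ _ 𝒢 h𝒢 φ hφ hg hreg hgen W hW hWN
    have hWtop : W ≠ ⊤ := by
      rintro rfl
      simp at hW
    -- One linear form has to be general for `N` and for all `P i` simultaneously.
    obtain ⟨w, hwW, hw⟩ := exists_linForm_notMem
      ((associatedPrimes.finite (MvPolynomial (Fin n) k) N).union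
        (Set.finite_iUnion fun i => associatedPrimes.finite (MvPolynomial (Fin n) k) (P i))) hWtop
    obtain ⟨a, ha⟩ := exists_pow_smul_eq_zero (N := N) fun p hp => hw p (Or.inl hp)
    have hP : ∀ i, ∀ q, r - 1 < q → ∀ x ∈ 𝒢 i q, linForm w • x = 0 → x = 0 := by
      intro i q hq x hx hwx
      obtain ⟨b, hb⟩ := exists_pow_smul_eq_zero (N := P i) fun p hp =>
        hw p (Or.inr (Set.mem_iUnion.2 ⟨i, hp⟩))
      exact (hreg i).eq_zero_of_torsion (h𝒢 i) b hq hx (hb x hwx)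
    have hmap : ∀ i, smulRange (linForm w) N ≤ (smulRange (linForm w) (P i)).comap (φ i) := by
      rintro i _ ⟨y, rfl⟩
      exact ⟨φ i y, (map_smul _ _ _).symm⟩
    -- The quotient is killed by `W` and by `ℓ`, hence by a space of one dimension more, while `I`,
    -- `r` and `t` stay the same.
    have hquot : RegLE k n (quotientGrading 𝒩 (smulRange (linForm w) N)) (r + (t - 1) * m) := by
      refine ih (h𝒩.quotient w) (fun i => (h𝒢 i).quotient w)
        (fun i => Submodule.mapQ _ _ (φ i) (hmap i)) ?_ ?_
        (fun i => (hreg i).quotient (h𝒢 i) (hP i)) ?_ (W ⊔ Submodule.span k {w}) ?_ ?_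
      · rintro i q _ ⟨y, hy, rfl⟩
        exact ⟨φ i y, hφ i q y hy, rfl⟩
      · intro i f hf
        obtain ⟨g, hg⟩ := hg i f hf
        refine ⟨Submodule.mapQ _ _ g ?_, fun x => ?_⟩
        · rintro _ ⟨y, rfl⟩
          exact ⟨g y, (map_smul _ _ _).symm⟩
        · obtain ⟨y, rfl⟩ := Submodule.mkQ_surjective _ x
          exact congrArg (Submodule.mkQ _) (hg y)
      · rintro q hq _ ⟨y, hy, rfl⟩
        have := Submodule.mem_map_of_mem (f := (smulRange (linForm w) N).mkQ) (hgen q hq y hy)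
        rw [Submodule.map_smul''] at this
        exact Submodule.smul_mono le_rfl le_top this
      · rw [Submodule.finrank_sup_span_singleton hwW]
        omega
      · intro w' hw' x
        obtain ⟨y, rfl⟩ := Submodule.mkQ_surjective _ x
        obtain ⟨w₁, hw₁, w₂, hw₂, rfl⟩ := Submodule.mem_sup.1 hw'
        obtain ⟨c, rfl⟩ := Submodule.mem_span_singleton.1 hw₂
        rw [linForm_add, linForm_smul, add_smul, ← map_smul, hWN _ hw₁, map_zero, zero_add,
          mul_comm, mul_smul]
        refine (Submodule.Quotient.mk_eq_zero (smulRange (linForm w) N)).2 ?_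
        exact ⟨(C c : MvPolynomial (Fin n) k) • y, rfl⟩
    have hmt : r ≤ r + ((t : ℤ) - 1) * m := by
      have : 0 ≤ ((t : ℤ) - 1) * m := mul_nonneg (by omega) (by omega)
      omega
    have hsm : r + ((t : ℤ) - 1) * ((m + 1 : ℕ) : ℤ) = r + ((t : ℤ) - 1) * m + (t - 1) := by
      push_cast
      ring
    rw [hsm]
    refine RegLE.of_quotient h𝒩 (w := w) (fun i j hij => hquot i j (by omega))
      fun q hq x hx hwx => ?_
    -- Degrees above `s + (t - 1)` are exactly those that permit `t` divisions, with `s` the bound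
    -- for the quotient. This leaves `y` in degree at least `s`, hence above `r - 1`.
    obtain ⟨y, hy, rfl, b, hb⟩ := exists_torsion_pow_smul_eq h𝒩 hquot ha t (b := a) (by omega) hx
      (ha x hwx)
    have hφy : ∀ i, φ i y = 0 := fun i =>
      (hreg i).eq_zero_of_torsion (h𝒢 i) b (by omega) (hφ i _ y hy) fun f hf => by
        rw [← map_smul, hb f hf, map_zero]
    -- Each `f ∈ I i` kills `y`, because `f y` is a value of a map at `φ i y = 0`; so the sum of the
    -- ideals kills `y`.
    have hmem : linForm w ^ t ∈ ⨆ i, I i :=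
      hI (Ideal.pow_mem_pow (linForm_mem_idealOfVars w) t)
    generalize linForm w ^ t = F at hmem
    induction hmem using Submodule.iSup_induction' with
    | mem i f hf =>
      obtain ⟨g, hg⟩ := hg i f hf
      rw [← hg, hφy, map_zero]
    | zero => exact zero_smul _ _
    | add f g _ _ hf hg => rw [add_smul, hf, hg, add_zero]

end Induction

/-- Additive maps that commute with the variables commute with the Koszul differentials. -/
theorem koszulD_comp {k : Type v} [Field k] {K : Type w} [Field K] {n : ℕ}
    {M : Type*} [AddCommGroup M] [Module (MvPolynomial (Fin n) k) M]
    {M' : Type*} [AddCommGroup M'] [Module (MvPolynomial (Fin n) K) M'] (h : M →+ M')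
    (hX : ∀ (a : Fin n) (x : M),
      h ((X a : MvPolynomial (Fin n) k) • x) = (X a : MvPolynomial (Fin n) K) • h x)
    (c : Finset (Fin n) → M) :
    koszulD K n M' (fun A => h (c A)) = fun B => h (koszulD k n M c B) := by
  funext B
  rw [koszulD_apply, koszulD_apply, map_sum]
  refine Finset.sum_congr rfl fun a _ => ?_
  unfold koszulSign
  rw [← hX]
  rcases Nat.even_or_odd (B.filter (· < a)).card with he | he
  · rw [he.neg_one_pow, he.neg_one_pow, one_smul, one_smul]
  · rw [he.neg_one_pow, he.neg_one_pow, neg_one_smul, neg_one_smul, map_neg]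

/-! ### Extension of the ground field -/

section BaseChange

open TensorProduct

attribute [local instance] MvPolynomial.algebraMvPolynomial

variable {k : Type v} [Field k] {n : ℕ} {K : Type w} [Field K] [Algebra k K]
variable {κ : Type w} (b : Module.Basis κ k K)
variable {N : Type u} [AddCommGroup N] [Module (MvPolynomial (Fin n) k) N]
variable {N' : Type u} [AddCommGroup N'] [Module (MvPolynomial (Fin n) k) N']

/-- A basis of `K` over `k` is a basis of `K[x_1, …, x_n]` over `k[x_1, …, x_n]`. -/
noncomputable def polyBasis (n : ℕ) (b : Module.Basis κ k K) :
    Module.Basis κ (MvPolynomial (Fin n) k) (MvPolynomial (Fin n) K) :=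
  IsBaseChange.basis b (Algebra.IsPushout.out (R := k) (S := MvPolynomial (Fin n) k) (R' := K)
    (S' := MvPolynomial (Fin n) K))

theorem polyBasis_apply (i : κ) : polyBasis n b i = C (b i) :=
  IsBaseChange.basis_apply _ _ i

theorem polyBasis_repr_C (a : K) (i : κ) : (polyBasis n b).repr (C a) i = C (b.repr a i) := by
  have h : (C a : MvPolynomial (Fin n) K) =
      (b.repr a).sum fun i c => (C c : MvPolynomial (Fin n) k) • polyBasis n b i := by
    conv_lhs => rw [← b.linearCombination_repr a, Finsupp.linearCombination_apply, Finsupp.sum,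
      map_sum]
    refine Finset.sum_congr rfl fun i _ => ?_
    beta_reduce
    rw [polyBasis_apply, Algebra.smul_def, Algebra.smul_def, map_mul]
    congr 1
    exact (map_C _ _).symm
  classical
  rw [h, Finsupp.sum, map_sum, Finsupp.finsetSum_apply]
  simp only [map_smul, Module.Basis.repr_self, Finsupp.smul_apply, Finsupp.single_apply,
    smul_eq_mul, mul_ite, mul_one, mul_zero, Finset.sum_ite_eq', Finsupp.mem_support_iff]
  split_ifs with h0
  · rfl
  · rw [not_not.1 h0, map_zero]

/-- Coordinates of a constant are constants, and monomials have coefficients in `k`, so taking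
coordinates acts on coefficients only. -/
theorem polyBasis_repr_isHomogeneous {f : MvPolynomial (Fin n) K} {e : ℕ} (hf : f.IsHomogeneous e)
    (i : κ) : ((polyBasis n b).repr f i).IsHomogeneous e := by
  rw [f.as_sum, map_sum, Finsupp.finsetSum_apply]
  refine IsHomogeneous.sum _ _ _ fun m hm => ?_
  have h : monomial m (coeff m f) = (monomial m 1 : MvPolynomial (Fin n) k) •
      (C (coeff m f) : MvPolynomial (Fin n) K) := by
    rw [Algebra.smul_def, mul_comm]
    change _ = C _ * MvPolynomial.map (algebraMap k K) (monomial m 1)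
    rw [map_monomial, map_one, C_mul_monomial, mul_one]
  rw [h, map_smul, Finsupp.smul_apply, polyBasis_repr_C, smul_eq_mul]
  simpa using (isHomogeneous_monomial (1 : k)
    (by rw [← hf (mem_support_iff.1 hm), Finsupp.degree_eq_weight_one]; rfl)).mul
      (isHomogeneous_C (Fin n) (b.repr (coeff m f) i))

/-- The coordinates of an element of `K[x_1, …, x_n] ⊗ N`. -/
noncomputable def tensorCoord (b : Module.Basis κ k K) (N : Type u) [AddCommGroup N]
    [Module (MvPolynomial (Fin n) k) N] (i : κ) :
    MvPolynomial (Fin n) K ⊗[MvPolynomial (Fin n) k] N →ₗ[MvPolynomial (Fin n) k] N :=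
  (TensorProduct.lid _ N).toLinearMap ∘ₗ ((polyBasis n b).coord i).rTensor N

theorem tensorCoord_tmul (i : κ) (f : MvPolynomial (Fin n) K) (x : N) :
    tensorCoord b N i (f ⊗ₜ x) = (polyBasis n b).repr f i • x := by
  simp [tensorCoord]

/-- Only finitely many coordinates are nonzero. Allowing every larger set lets a single one serve
all coefficients of a chain. -/
theorem exists_finset_tensorCoord (z : MvPolynomial (Fin n) K ⊗[MvPolynomial (Fin n) k] N) :
    ∃ T : Finset κ, ∀ T' : Finset κ, T ⊆ T' →
      ∑ i ∈ T', polyBasis n b i ⊗ₜ[MvPolynomial (Fin n) k] tensorCoord b N i z = z := by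
  classical
  refine ⟨(TensorProduct.equivFinsuppOfBasisLeft (polyBasis n b) z).support, fun T' hT' => ?_⟩
  have h := (TensorProduct.equivFinsuppOfBasisLeft (N := N) (polyBasis n b)).symm_apply_apply z
  rw [TensorProduct.equivFinsuppOfBasisLeft_symm_apply, Finsupp.sum] at h
  rw [← Finset.sum_subset hT']
  · conv_rhs => rw [← h]
    refine Finset.sum_congr rfl fun i _ => ?_
    rw [TensorProduct.equivFinsuppOfBasisLeft_apply]
    rfl
  · intro i _ hi
    rw [Finsupp.notMem_support_iff, TensorProduct.equivFinsuppOfBasisLeft_apply] at hi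
    change tensorCoord b N i z = 0 at hi
    rw [hi, tmul_zero]

theorem tensorCoord_baseChange (φ : N →ₗ[MvPolynomial (Fin n) k] N') (i : κ)
    (z : MvPolynomial (Fin n) K ⊗[MvPolynomial (Fin n) k] N) :
    tensorCoord b N' i (φ.baseChange (MvPolynomial (Fin n) K) z) = φ (tensorCoord b N i z) := by
  induction z using TensorProduct.induction_on with
  | zero => simp
  | tmul f x => simp [tensorCoord_tmul]
  | add x y hx hy => simp only [map_add, hx, hy]

/-- The grading of `K[x_1, …, x_n] ⊗ N`. -/
noncomputable def tensorGrading (n : ℕ) (b : Module.Basis κ k K) {N : Type u} [AddCommGroup N]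
    [Module (MvPolynomial (Fin n) k) N] (𝒩 : ℤ → AddSubgroup N) (q : ℤ) :
    AddSubgroup (MvPolynomial (Fin n) K ⊗[MvPolynomial (Fin n) k] N) :=
  ⨅ i, (𝒩 q).comap (tensorCoord b N i).toAddMonoidHom

variable {𝒩 : ℤ → AddSubgroup N}

theorem mem_tensorGrading {q : ℤ} {z : MvPolynomial (Fin n) K ⊗[MvPolynomial (Fin n) k] N} :
    z ∈ tensorGrading n b 𝒩 q ↔ ∀ i, tensorCoord b N i z ∈ 𝒩 q := by
  simp [tensorGrading, AddSubgroup.mem_iInf]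

theorem tmul_mem_tensorGrading (h𝒩 : IsGradedModule k n 𝒩) {f : MvPolynomial (Fin n) K} {e : ℕ}
    (hf : f.IsHomogeneous e) {q : ℤ} {x : N} (hx : x ∈ 𝒩 q) :
    f ⊗ₜ[MvPolynomial (Fin n) k] x ∈ tensorGrading n b 𝒩 (q + e) := by
  rw [mem_tensorGrading]
  intro i
  rw [tensorCoord_tmul]
  exact h𝒩.smul_mem (polyBasis_repr_isHomogeneous b hf i) hx

theorem polyBasis_tmul_mem_tensorGrading (h𝒩 : IsGradedModule k n 𝒩) (i : κ) {q : ℤ} {x : N}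
    (hx : x ∈ 𝒩 q) : polyBasis n b i ⊗ₜ[MvPolynomial (Fin n) k] x ∈ tensorGrading n b 𝒩 q := by
  rw [polyBasis_apply]
  simpa using tmul_mem_tensorGrading b h𝒩 (isHomogeneous_C (Fin n) (b i)) hx

theorem IsGradedModule.baseChange (h𝒩 : IsGradedModule k n 𝒩) :
    IsGradedModule K n (tensorGrading n b 𝒩) := by
  refine ⟨isInternal_of_separating ?_ fun q => ?_, ?_⟩
  · rw [eq_top_iff]
    rintro z -
    obtain ⟨T, hT⟩ := exists_finset_tensorCoord b z
    rw [← hT T subset_rfl]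
    refine sum_mem fun i _ => ?_
    have hx : tensorCoord b N i z ∈ ⨆ q, 𝒩 q := by
      rw [iSup_eq_top_of_isInternal h𝒩.isInternal]
      trivial
    generalize tensorCoord b N i z = x at hx
    induction hx using AddSubgroup.iSup_induction' with
    | hp q x hx => exact AddSubgroup.mem_iSup_of_mem q (polyBasis_tmul_mem_tensorGrading b h𝒩 i hx)
    | h1 => simp
    | hadd x y _ _ hx hy =>
      rw [tmul_add]
      exact add_mem hx hy
  · obtain ⟨p, hp1, hp2, hp3⟩ := exists_proj_of_isInternal h𝒩.isInternal
    refine ⟨κ → N, inferInstance, AddMonoidHom.mk'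
      (fun z i => p q (tensorCoord b N i z)) fun x y => ?_, fun z hz h => ?_, fun q' hq' z hz => ?_⟩
    · funext i
      simp
    · rw [mem_tensorGrading] at hz
      obtain ⟨T, hT⟩ := exists_finset_tensorCoord b z
      rw [← hT T subset_rfl]
      refine Finset.sum_eq_zero fun i _ => ?_
      have : p q (tensorCoord b N i z) = 0 := congrFun h i
      rw [← hp2 q _ (hz i), this, tmul_zero]
    · rw [mem_tensorGrading] at hz
      funext i
      exact hp3 q q' hq' _ (hz i)
  · intro e f hf q z hz
    rw [mem_tensorGrading] at hz
    obtain ⟨T, hT⟩ := exists_finset_tensorCoord b z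
    rw [← hT T subset_rfl, Finset.smul_sum]
    refine sum_mem fun i _ => ?_
    rw [smul_tmul', smul_eq_mul, polyBasis_apply]
    refine tmul_mem_tensorGrading b h𝒩 ?_ (hz i)
    simpa using hf.mul (isHomogeneous_C (Fin n) (b i))

theorem X_smul_tensor (a : Fin n) (z : MvPolynomial (Fin n) K ⊗[MvPolynomial (Fin n) k] N) :
    (X a : MvPolynomial (Fin n) k) • z = (X a : MvPolynomial (Fin n) K) • z := by
  rw [← algebraMap_smul (MvPolynomial (Fin n) K) (X a : MvPolynomial (Fin n) k) z]
  congr 1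
  exact map_X _ _

theorem koszulD_tensorCoord (i : κ)
    (c : Finset (Fin n) → MvPolynomial (Fin n) K ⊗[MvPolynomial (Fin n) k] N) :
    koszulD k n N (fun A => tensorCoord b N i (c A)) =
      fun B => tensorCoord b N i (koszulD K n _ c B) :=
  koszulD_comp (tensorCoord b N i).toAddMonoidHom
    (fun a x => by
      rw [← X_smul_tensor]
      exact map_smul (tensorCoord b N i) _ _) c

theorem koszulD_tmul (f : MvPolynomial (Fin n) K) (c : Finset (Fin n) → N) :
    koszulD K n _ (fun A => f ⊗ₜ[MvPolynomial (Fin n) k] c A) =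
      fun B => f ⊗ₜ[MvPolynomial (Fin n) k] koszulD k n N c B :=
  koszulD_comp (TensorProduct.mk (MvPolynomial (Fin n) k) _ N f).toAddMonoidHom
    (fun a x => by
      rw [← X_smul_tensor]
      exact map_smul (TensorProduct.mk (MvPolynomial (Fin n) k) _ N f) _ _) c

/-- The Koszul differential acts coordinatewise, so each coordinate of a cycle is bounded over `k`
and finitely many bounding chains are reassembled. -/
theorem RegLE.baseChange (h𝒩 : IsGradedModule k n 𝒩) {s : ℤ} (h : RegLE k n 𝒩 s) :
    RegLE K n (tensorGrading n b 𝒩) s := by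
  classical
  intro i j hij c hc hd
  have hex : ∀ l, ∃ e ∈ koszulChains n 𝒩 (i + 1) j,
      koszulD k n N e = fun A => tensorCoord b N l (c A) := fun l => by
    refine h i j hij _ ⟨fun A => (mem_tensorGrading b).1 (hc.1 A) l, fun A hA => ?_⟩ ?_
    · exact (congrArg (tensorCoord b N l) (hc.2 A hA)).trans (map_zero _)
    · rw [koszulD_tensorCoord, hd]
      funext A
      exact map_zero _
  choose e he hde using hex
  choose T hT using fun A => exists_finset_tensorCoord b (c A)
  refine ⟨∑ l ∈ Finset.univ.biUnion T, fun A => polyBasis n b l ⊗ₜ e l A,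
    sum_mem fun l _ => ⟨fun A => polyBasis_tmul_mem_tensorGrading b h𝒩 l ((he l).1 A),
      fun A hA => ?_⟩, ?_⟩
  · beta_reduce
    rw [(he l).2 A hA, tmul_zero]
  · rw [map_sum]
    funext A
    rw [Finset.sum_apply]
    simp only [koszulD_tmul, hde]
    exact hT A _ (Finset.subset_biUnion_of_mem T (Finset.mem_univ A))

theorem RegLE.of_baseChange (h𝒩 : IsGradedModule k n 𝒩) {s : ℤ}
    (h : RegLE K n (tensorGrading n b 𝒩) s) : RegLE k n 𝒩 s := by
  intro i j hij c hc hd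
  -- The basis need not contain `1`. A coordinate in which `1` does not vanish, divided by its value
  -- there, retracts `K[x] ⊗ N` onto `N`.
  obtain ⟨l, hl⟩ : ∃ l, b.repr 1 l ≠ 0 := by
    by_contra! h0
    exact one_ne_zero (b.repr.map_eq_zero_iff.1 (Finsupp.ext h0))
  obtain ⟨e, he, hde⟩ := h i j hij (fun A => 1 ⊗ₜ c A)
    ⟨fun A => by simpa using tmul_mem_tensorGrading b h𝒩 (isHomogeneous_one (Fin n) K) (hc.1 A),
      fun A hA => (congrArg _ (hc.2 A hA)).trans (tmul_zero _ _)⟩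
    (by
      rw [koszulD_tmul, hd]
      funext A
      exact tmul_zero _ _)
  refine ⟨(C (b.repr 1 l)⁻¹ : MvPolynomial (Fin n) k) • fun A => tensorCoord b N l (e A),
    ⟨fun A => h𝒩.C_smul_mem _ ((mem_tensorGrading b).1 (he.1 A) l), fun A hA => ?_⟩, ?_⟩
  · rw [Pi.smul_apply, he.2 A hA, map_zero, smul_zero]
  · rw [map_smul, koszulD_tensorCoord, hde]
    funext A
    rw [Pi.smul_apply, tensorCoord_tmul, ← C_1, polyBasis_repr_C, smul_smul, ← C_mul,
      inv_mul_cancel₀ hl, C_1, one_smul]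

theorem map_idealOfVars :
    (idealOfVars (Fin n) k).map (algebraMap (MvPolynomial (Fin n) k) (MvPolynomial (Fin n) K)) =
      idealOfVars (Fin n) K := by
  rw [idealOfVars, Ideal.map_span, ← Set.range_comp]
  congr 2
  funext a
  exact map_X _ _

theorem tmul_mem_idealOfVars_smul (f : MvPolynomial (Fin n) K) {x : N}
    (hx : x ∈ idealOfVars (Fin n) k • (⊤ : Submodule (MvPolynomial (Fin n) k) N)) :
    f ⊗ₜ[MvPolynomial (Fin n) k] x ∈ idealOfVars (Fin n) K • (⊤ : Submodule (MvPolynomial (Fin n) K)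
      (MvPolynomial (Fin n) K ⊗[MvPolynomial (Fin n) k] N)) := by
  refine Submodule.smul_induction_on hx (fun g hg y _ => ?_) fun y z hy hz => ?_
  · rw [tmul_smul, ← algebraMap_smul (MvPolynomial (Fin n) K) g]
    refine Submodule.smul_mem_smul ?_ trivial
    rw [← map_idealOfVars (k := k)]
    exact Ideal.mem_map_of_mem _ hg
  · rw [tmul_add]
    exact add_mem hy hz

/-- The hyperplane section bound over an arbitrary field. -/
theorem regLE_of_approximations {d t : ℕ} (ht : 1 ≤ t)
    {I : Fin d → Ideal (MvPolynomial (Fin n) k)} (hI : idealOfVars (Fin n) k ^ t ≤ ⨆ i, I i)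
    {r : ℤ} [Module.Finite (MvPolynomial (Fin n) k) N] (h𝒩 : IsGradedModule k n 𝒩)
    {P : Fin d → Type u} [∀ i, AddCommGroup (P i)] [∀ i, Module (MvPolynomial (Fin n) k) (P i)]
    [∀ i, Module.Finite (MvPolynomial (Fin n) k) (P i)]
    {𝒢 : ∀ i, ℤ → AddSubgroup (P i)} (h𝒢 : ∀ i, IsGradedModule k n (𝒢 i))
    {φ : ∀ i, N →ₗ[MvPolynomial (Fin n) k] P i}
    (hφ : ∀ i, IsDegreePreserving 𝒩 (𝒢 i) (φ i))
    (hg : ∀ i, ∀ f ∈ I i, ∃ g : P i →ₗ[MvPolynomial (Fin n) k] N, ∀ x, g (φ i x) = f • x)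
    (hreg : ∀ i, RegLE k n (𝒢 i) (r - 1))
    (hgen : ∀ q, r < q → ∀ x ∈ 𝒩 q,
      x ∈ idealOfVars (Fin n) k • (⊤ : Submodule (MvPolynomial (Fin n) k) N)) :
    RegLE k n 𝒩 (r + (t - 1) * n) := by
  -- The algebraic closure serves only as an infinite extension field.
  let b := Module.Free.chooseBasis k (AlgebraicClosure k)
  refine RegLE.of_baseChange b h𝒩 ?_
  refine regLE_of_factorization ht (fun i => (I i).map (algebraMap (MvPolynomial (Fin n) k)
    (MvPolynomial (Fin n) (AlgebraicClosure k)))) ?_ n (h𝒩.baseChange b)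
    (fun i => (h𝒢 i).baseChange b)
    (fun i => (φ i).baseChange (MvPolynomial (Fin n) (AlgebraicClosure k))) ?_ ?_
    (fun i => (hreg i).baseChange b (h𝒢 i)) ?_ ⊥ ?_ ?_
  · rw [← map_idealOfVars (k := k), ← Ideal.map_pow, ← Ideal.map_iSup]
    exact Ideal.map_mono hI
  · intro i q z hz
    rw [mem_tensorGrading] at hz ⊢
    intro l
    rw [tensorCoord_baseChange]
    exact hφ i q _ (hz l)
  -- The polynomials whose multiplication factors through the extended map form an ideal, so it
  -- suffices to treat the images of elements of `I i`.
  · intro i f hf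
    refine Submodule.span_induction ?_ ⟨0, fun x => ?_⟩ ?_ ?_ hf
    · rintro _ ⟨f, hf, rfl⟩
      obtain ⟨g, hg⟩ := hg i f hf
      refine ⟨g.baseChange _, fun z => ?_⟩
      have hgφ : g ∘ₗ φ i = LinearMap.lsmul _ N f := LinearMap.ext hg
      rw [← LinearMap.comp_apply, ← LinearMap.baseChange_comp, hgφ]
      induction z using TensorProduct.induction_on with
      | zero => simp
      | tmul a x =>
        rw [LinearMap.baseChange_tmul, LinearMap.lsmul_apply, tmul_smul]
        exact (algebraMap_smul _ _ _).symm
      | add x y hx hy => rw [map_add, hx, hy, smul_add]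
    · rw [zero_smul, LinearMap.zero_apply]
    · rintro f f' _ _ ⟨g, hg⟩ ⟨g', hg'⟩
      exact ⟨g + g', fun x => by rw [LinearMap.add_apply, hg, hg', add_smul]⟩
    · rintro a f _ ⟨g, hg⟩
      exact ⟨a • g, fun x => by rw [LinearMap.smul_apply, hg, smul_eq_mul, mul_smul]⟩
  · intro q hq z hz
    rw [mem_tensorGrading] at hz
    obtain ⟨T, hT⟩ := exists_finset_tensorCoord b z
    rw [← hT T subset_rfl]
    exact sum_mem fun l _ => tmul_mem_idealOfVars_smul _ (hgen q hq _ (hz l))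
  · simp
  · intro w hw x
    rw [(Submodule.mem_bot _).1 hw]
    simp [linForm]

end BaseChange

/-! ### Approximations, generators and extended real bounds -/

section Regularity

variable {k : Type v} [Field k] {n : ℕ}
variable {N : Type u} [AddCommGroup N] [Module (MvPolynomial (Fin n) k) N]
variable {N' : Type u} [AddCommGroup N'] [Module (MvPolynomial (Fin n) k) N']
variable {𝒩 : ℤ → AddSubgroup N} {𝒩' : ℤ → AddSubgroup N'}

/-- If `φ` is an `I`-approximation, then multiplication by an element of `I` factors through `φ`. -/
theorem IsApproximation.exists_comp_eq_smul {I : Ideal (MvPolynomial (Fin n) k)}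
    {φ : N →ₗ[MvPolynomial (Fin n) k] N'} (h : IsApproximation 𝒩 𝒩' I φ)
    {f : MvPolynomial (Fin n) k} (hf : f ∈ I) :
    ∃ g : N' →ₗ[MvPolynomial (Fin n) k] N, ∀ x, g (φ x) = f • x := by
  obtain ⟨Z, _, _, α, β, rfl, hα, hβ, hcoker, hker, -⟩ := h
  have hmem : ∀ z, f • z ∈ LinearMap.range α := fun z => by
    have := Module.mem_annihilator.1 (hcoker hf) ((LinearMap.range α).mkQ z)
    rw [← map_smul] at this
    exact (Submodule.Quotient.mk_eq_zero _).1 this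
  -- Since `f Z ⊆ α(N)`, the map `z ↦ α⁻¹(f z)` is defined. It kills `ker β` because `f` does, so it
  -- descends to `N'`.
  let h : Z →ₗ[MvPolynomial (Fin n) k] N := (LinearEquiv.ofInjective α hα).symm.toLinearMap ∘ₗ
    (LinearMap.lsmul (MvPolynomial (Fin n) k) Z f).codRestrict (LinearMap.range α) hmem
  have hh : ∀ z, α (h z) = f • z := fun z =>
    congrArg Subtype.val ((LinearEquiv.ofInjective α hα).apply_symm_apply ⟨f • z, hmem z⟩)
  have hβh : LinearMap.ker β ≤ LinearMap.ker h := fun z hz => by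
    refine hα ?_
    rw [hh, map_zero]
    exact congrArg Subtype.val (Module.mem_annihilator.1 (hker hf) ⟨z, hz⟩)
  refine ⟨(LinearMap.ker β).liftQ h hβh ∘ₗ (β.quotKerEquivOfSurjective hβ).symm.toLinearMap,
    fun x => hα ?_⟩
  have hx : (β.quotKerEquivOfSurjective hβ).symm (β (α x)) = (LinearMap.ker β).mkQ (α x) :=
    (LinearEquiv.symm_apply_eq _).2 rfl
  change α ((LinearMap.ker β).liftQ h hβh ((β.quotKerEquivOfSurjective hβ).symm (β (α x)))) = _
  rw [hx, Submodule.mkQ_apply, Submodule.liftQ_apply, hh, map_smul]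

theorem exists_sub_C_mem_idealOfVars (f : MvPolynomial (Fin n) k) :
    ∃ c, f - C c ∈ idealOfVars (Fin n) k := by
  induction f using MvPolynomial.induction_on with
  | C a => exact ⟨a, by simp⟩
  | add f g hf hg =>
    obtain ⟨a, ha⟩ := hf
    obtain ⟨b, hb⟩ := hg
    refine ⟨a + b, ?_⟩
    rw [map_add, add_sub_add_comm]
    exact add_mem ha hb
  | mul_X f i _ =>
    refine ⟨0, ?_⟩
    rw [map_zero, sub_zero]
    exact Ideal.mul_mem_left _ _ (Ideal.subset_span ⟨i, rfl⟩)

/-- Among finite homogeneous generating sets, one of least cardinality is irredundant. -/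
theorem exists_isMinimalGeneratingSet [Module.Finite (MvPolynomial (Fin n) k) N]
    (h𝒩 : IsGradedModule k n 𝒩) : ∃ G : Set N, IsMinimalGeneratingSet k n 𝒩 G := by
  classical
  have htop : Submodule.span (MvPolynomial (Fin n) k) {x : N | ∃ q, x ∈ 𝒩 q} = ⊤ := by
    rw [eq_top_iff]
    rintro x -
    have hx : x ∈ ⨆ q, 𝒩 q := by
      rw [iSup_eq_top_of_isInternal h𝒩.isInternal]
      trivial
    induction hx using AddSubgroup.iSup_induction' with
    | hp q x hx => exact Submodule.subset_span ⟨q, hx⟩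
    | h1 => exact zero_mem _
    | hadd x y _ _ hx hy => exact add_mem hx hy
  have hfg : (Submodule.span (MvPolynomial (Fin n) k) {x : N | ∃ q, x ∈ 𝒩 q}).FG := by
    rw [htop]
    exact Module.Finite.fg_top
  obtain ⟨T₀, hT₀, hspan₀⟩ := (Submodule.fg_span_iff_fg_span_finset_subset _).1 hfg
  obtain ⟨T, ⟨hT, hspan⟩, hmin⟩ := WellFounded.has_min (measure (Finset.card (α := N))).wf
    {T : Finset N | (∀ x ∈ T, ∃ q, x ∈ 𝒩 q) ∧
      Submodule.span (MvPolynomial (Fin n) k) (T : Set N) = ⊤}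
    ⟨T₀, fun x hx => hT₀ hx, hspan₀.symm.trans htop⟩
  refine ⟨T, hT, hspan, fun g hg h => ?_⟩
  refine hmin (T.erase g) ⟨fun x hx => hT x (Finset.mem_of_mem_erase hx), ?_⟩
    (Finset.card_erase_lt_of_mem hg)
  rwa [Finset.coe_erase]

/-- If `N` has generators in degrees at most `r`, then its components of higher degrees lie in
`𝔪 N`. -/
theorem IsGradedModule.mem_idealOfVars_smul (h𝒩 : IsGradedModule k n 𝒩) {G : Set N} {r : ℤ}
    (hG : ∀ g ∈ G, ∃ j ≤ r, g ∈ 𝒩 j) (hspan : Submodule.span (MvPolynomial (Fin n) k) G = ⊤)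
    {q : ℤ} (hq : r < q) {x : N} (hx : x ∈ 𝒩 q) :
    x ∈ idealOfVars (Fin n) k • (⊤ : Submodule (MvPolynomial (Fin n) k) N) := by
  obtain ⟨p, hp1, hp2, hp3⟩ := exists_proj_of_isInternal h𝒩.isInternal
  have hm : ∀ f ∈ idealOfVars (Fin n) k, ∀ (y : N),
      p q (f • y) ∈ idealOfVars (Fin n) k • (⊤ : Submodule (MvPolynomial (Fin n) k) N) := by
    intro f hf
    refine Submodule.span_induction ?_ (fun y => ?_) (fun a b _ _ ha hb y => ?_)
      (fun a b _ hb y => ?_) hf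
    · rintro _ ⟨a, rfl⟩ y
      have := h𝒩.proj_smul hp2 hp3 (isHomogeneous_X k a) (q - 1) y
      simp only [Nat.cast_one, sub_add_cancel] at this
      rw [this]
      exact Submodule.smul_mem_smul (Ideal.subset_span ⟨a, rfl⟩) trivial
    · rw [zero_smul, map_zero]
      exact zero_mem _
    · rw [add_smul, map_add]
      exact add_mem (ha y) (hb y)
    · rw [smul_eq_mul, mul_comm, mul_smul]
      exact hb _
  -- The statement is extended to the degree-`q` component of an arbitrary `y` to allow induction
  -- over the span. Generators have no component in degree `q`, constants commute with the
  -- projection, and `hm` covers the rest of a coefficient.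
  have key : ∀ y : N,
      p q y ∈ idealOfVars (Fin n) k • (⊤ : Submodule (MvPolynomial (Fin n) k) N) := by
    intro y
    have hy : y ∈ Submodule.span (MvPolynomial (Fin n) k) G := by
      rw [hspan]
      trivial
    induction hy using Submodule.span_induction with
    | mem g hg =>
      obtain ⟨j, hj, hgj⟩ := hG g hg
      rw [hp3 q j (by omega) g hgj]
      exact zero_mem _
    | zero =>
      rw [map_zero]
      exact zero_mem _
    | add y z _ _ hy hz =>
      rw [map_add]
      exact add_mem hy hz
    | smul a y _ hy =>
      obtain ⟨c, hc⟩ := exists_sub_C_mem_idealOfVars a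
      have h1 := h𝒩.proj_smul hp2 hp3 (isHomogeneous_C (Fin n) c) q y
      rw [Nat.cast_zero, add_zero] at h1
      rw [← sub_add_cancel a (C c), add_smul, map_add, h1]
      exact add_mem (hm _ hc y) (Submodule.smul_mem _ _ hy)
  rw [← hp2 q x hx]
  exact key x

theorem regLE_of_reg_lt {s : ℤ} (h : reg k n 𝒩 < (((s + 1 : ℤ) : ℝ) : EReal)) : RegLE k n 𝒩 s := by
  intro i j hij
  by_contra hne
  have h1 : ((((j - i : ℤ) : ℝ) : EReal)) ≤ reg k n 𝒩 :=
    le_sSup ⟨i, j, (nontrivial_gradedTor_iff i j).2 hne, rfl⟩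
  have h2 := h1.trans_lt h
  rw [EReal.coe_lt_coe_iff, Int.cast_lt] at h2
  omega

theorem lt_coe_sub_of_add_coe_lt {a : EReal} {x y : ℝ} (h : a + (x : EReal) < (y : EReal)) :
    a < ((y - x : ℝ) : EReal) := by
  by_contra! hle
  have h1 : ((y - x : ℝ) : EReal) + (x : EReal) ≤ a + (x : EReal) := by gcongr
  rw [← EReal.coe_add, sub_add_cancel] at h1
  exact absurd h h1.not_gt

end Regularity

end GenApprox

theorem theorem4p10 {k : Type v} [Field k] {n : ℕ}
    {N : Type u} [AddCommGroup N] [Module (MvPolynomial (Fin n) k) N]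
    [Module.Finite (MvPolynomial (Fin n) k) N]
    (𝒩 : ℤ → AddSubgroup N) (h𝒩 : GenApprox.IsGradedModule k n 𝒩)
    {d t : ℕ} (ht : 1 ≤ t)
    {P : Fin d → Type u} [∀ i, AddCommGroup (P i)] [∀ i, Module (MvPolynomial (Fin n) k) (P i)]
    [∀ i, Module.Finite (MvPolynomial (Fin n) k) (P i)]
    (𝒢 : ∀ i, ℤ → AddSubgroup (P i)) (h𝒢 : ∀ i, GenApprox.IsGradedModule k n (𝒢 i))
    (φ : ∀ i, N →ₗ[MvPolynomial (Fin n) k] P i)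
    (I : Fin d → Ideal (MvPolynomial (Fin n) k))
    (hφ : GenApprox.IsGeneralizedApproximationSystem t 𝒩 𝒢 φ I) :
    GenApprox.reg k n 𝒩 ≤
      max ((⨆ i, GenApprox.reg k n (𝒢 i)) + 1) (GenApprox.maxGeneratorDegree k n 𝒩) +
        ((((t : ℝ) - 1) * (n : ℝ) : ℝ) : EReal) := by
  refine sSup_le ?_
  rintro _ ⟨i, j, hij, rfl⟩
  by_contra! hlt
  have hlt := GenApprox.lt_coe_sub_of_add_coe_lt hlt
  -- With this `r`, a nonzero `Tor` that violates the bound sits at `j - i = r + (t - 1) n + 1`,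
  -- just above what the integral version allows. Strict inequality with `r + 1` yields `reg ≤ r -
  -- 1` for the `P i` and generators in degrees at most `r`.
  obtain ⟨r, hr⟩ : ∃ r : ℤ, r = j - i - 1 - ((t : ℤ) - 1) * n := ⟨_, rfl⟩
  have hcast : (((j - i : ℤ) : ℝ) - ((t : ℝ) - 1) * (n : ℝ)) = ((r + 1 : ℤ) : ℝ) := by
    rw [hr]
    push_cast
    ring
  rw [hcast, max_lt_iff] at hlt
  obtain ⟨hreg, hgen⟩ := hlt
  have hsup : ⨆ i, GenApprox.reg k n (𝒢 i) < ((((r - 1) + 1 : ℤ) : ℝ) : EReal) := by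
    rw [← EReal.coe_one] at hreg
    have := GenApprox.lt_coe_sub_of_add_coe_lt hreg
    rwa [show ((r + 1 : ℤ) : ℝ) - 1 = ((r - 1 + 1 : ℤ) : ℝ) by push_cast; ring] at this
  obtain ⟨G, hG⟩ := GenApprox.exists_isMinimalGeneratingSet h𝒩
  have hGr : ∀ g ∈ G, ∃ q ≤ r, g ∈ 𝒩 q := by
    intro g hg
    obtain ⟨q, hq⟩ := hG.homogeneous g hg
    refine ⟨q, ?_, hq⟩
    have h1 : ((q : ℝ) : EReal) ≤ GenApprox.maxGeneratorDegree k n 𝒩 :=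
      le_sSup ⟨G, hG, g, hg, q, hq, rfl⟩
    have h2 := h1.trans_lt hgen
    rw [EReal.coe_lt_coe_iff, Int.cast_lt] at h2
    omega
  have hmain := GenApprox.regLE_of_approximations ht hφ.pow_le (r := r) h𝒩 h𝒢
    hφ.isDegreePreserving (fun i f hf => (hφ.isApproximation i).exists_comp_eq_smul hf)
    (fun i => GenApprox.regLE_of_reg_lt ((le_iSup _ i).trans_lt hsup))
    (fun q hq x hx => h𝒩.mem_idealOfVars_smul hGr hG.span_eq_top hq hx)
  refine (GenApprox.nontrivial_gradedTor_iff i j).1 hij (hmain i j ?_)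
  rw [hr]
  omega
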